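/- **Setting.** Let $\mathbb X$ be a nonempty standard Borel space with a $\sigma$-finite measure $\mu$, and let $\Theta$ be a nonempty separable metrizable space whose Borel $\sigma$-field $\mathcal B(\Theta)$ is standard (for instance a Polish space or a Borel subset of $\mathbb R^p$). Let $f(x\mid\theta)\in[0,\infty)$ be jointly measurable with $\int_{\mathbb X} f(x\mid\theta)\,d\mu(x)=1$ for every $\theta\in\Theta$. For a probability measure $H$ on $\Theta$ put $$f_H(x)=\int_\Theta f(x\mid\theta)\,dH(\theta),\qquad dF_H=f_H\,d\mu,\qquad P_H(A\mid x)=\frac{\int_A f(x\mid\theta)\,dH(\theta)}{\int_\Theta f(x\mid\theta)\,dH(\theta)},$$ with $P_H(\cdot\mid x):=H$ on the $F_H$-null set of those $x$ with $f_H(x)\in\{0,\infty\}$. Let $G_0$ be a probability measure on $\Theta$, let $(\alpha_n)_{n\ge1}$ be real numbers in $(0,1)$, and for a sequence $x_1,x_2,\dots$ in $\mathbb X$ define recursively $$G_n(\cdot)=(1-\alpha_n)\,G_{n-1}(\cdot)+\alpha_n\,P_{G_{n-1}}(\cdot\mid x_n),\qquad n\ge 1 .$$ Let $((X_n,\theta_n))_{n\ge1}$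 be a process with values in $\mathbb X\times\Theta$ on a probability space with probability $P$, such that for every $n\ge1$ the conditional law of $X_n$ given $(X_{1:n-1},\theta_{1:n})$ has density $f(\cdot\mid\theta_n)$ with respect to $\mu$, $\theta_1\sim G_0$, and the conditional law of $\theta_{n+1}$ given $X_{1:n}$ is $G_n$ (computed at $x_i=X_i$). No other assumption is made on the joint law. Conditional laws are regular versions. **Theorem.** Almost surely, $G_n$ converges weakly to a random probability measure $G$. For $A\in\mathcal B(\Theta)$ let $$V_A=\int_{\{x:\,f_G(x)\ne0\}}P_G(A\mid x)^2\,dF_G(x)-G(A)^2,\qquad V_{A,n}=\int_{\mathbb X}P_{G_n}(A\mid x)^2\,dF_{G_n}(x)-G_n(A)^2 .$$ (1) Suppose that $\sum_n\alpha_n=\infty$ and $\sum_n\alpha_n^2<\infty$, and let $(r_n)_{n\ge1}$ be a nondecreasing sequence of positive numbers with $r_n\sim\bigl(\sum_{k>n}\alpha_k^2\bigr)^{-1}$ as $n\to\infty$, $$\sqrt{r_n}\,\sup_{k\ge n}\alpha_k\to0\qquad\text{and}\qquad \sum_{k\ge1}r_k^2\,\alpha_{k+1}^4<\infty .$$ Then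 for every $A\in\mathcal B(\Theta)$ and for almost every $\omega$ with $V_A(\omega)>0$, writing $x_i=X_i(\omega)$: (a) for every $t\in\mathbb R$, $$P\Bigl(\sqrt{r_n}\,\frac{G(A)-G_n(A)}{\sqrt{V_{A,n}}}\le t\,\Big|\,x_{1:n}\Bigr)\longrightarrow\Phi(t),\qquad n\to\infty,$$ where $\Phi$ is the distribution function of $N(0,1)$ (the ratio is read as $0$ when $V_{A,n}=0$); (b) for every $\gamma\in(0,1)$, with $z_{1-\gamma/2}$ the $(1-\gamma/2)$-quantile of $N(0,1)$, $$P\Bigl(G_n(A)-z_{1-\gamma/2}\sqrt{V_{A,n}/r_n}<G(A)<G_n(A)+z_{1-\gamma/2}\sqrt{V_{A,n}/r_n}\,\Big|\,x_{1:n}\Bigr)\longrightarrow1-\gamma .$$ (2) If $\alpha_n=(a+n)^{-\beta}$ for all $n\ge1$, with $a>0$ and $1/2<\beta\le1$, then (a) and (b) hold, for every $A\in\mathcal B(\Theta)$ and almost every $\omega$ with $V_A(\omega)>0$, with $r_n=(2\beta-1)\,n^{2\beta-1}$. -/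

import Mathlib

open MeasureTheory ProbabilityTheory Filter Topology
open scoped NNReal ENNReal

noncomputable section

namespace NewtonMixture

variable {𝕏 Θ Ω : Type*} [MeasurableSpace 𝕏] [MeasurableSpace Θ] [MeasurableSpace Ω]

/-- The mixture density `f_H(x) = ∫ f(x ∣ θ) dH(θ)`; here `f x θ` stands for `f(x ∣ θ)`. -/
def mixDensity (f : 𝕏 → Θ → ℝ≥0) (H : ProbabilityMeasure Θ) (x : 𝕏) : ℝ≥0∞ :=
  ∫⁻ θ, (f x θ : ℝ≥0∞) ∂(H : Measure Θ)

/-- The mixture distribution `F_H`, with density `f_H` with respect to `μ`. -/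
def mixLaw (μ : Measure 𝕏) (f : 𝕏 → Θ → ℝ≥0) (H : ProbabilityMeasure Θ) : Measure 𝕏 :=
  μ.withDensity (mixDensity f H)

/-- The one-observation posterior `P_H(A ∣ x) = ∫_A f(x ∣ θ) dH(θ) / ∫ f(x ∣ θ) dH(θ)`.
The formula is meaningless at a point `x` where `f_H(x)` is `0` or `∞` (these points form an
`F_H`-null set when `F_H` is a probability measure); there the value is `H`. -/
def bayesUpdate (f : 𝕏 → Θ → ℝ≥0) (H : ProbabilityMeasure Θ) (x : 𝕏) :
    ProbabilityMeasure Θ :=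
  open Classical in
  if h : mixDensity f H x ≠ 0 ∧ mixDensity f H x ≠ ∞ then
    ⟨(mixDensity f H x)⁻¹ • (H : Measure Θ).withDensity (fun θ => (f x θ : ℝ≥0∞)), ⟨by
      rw [Measure.smul_apply, withDensity_apply _ MeasurableSet.univ, Measure.restrict_univ,
        smul_eq_mul]
      exact ENNReal.inv_mul_cancel h.1 h.2⟩⟩
  else H

/-- The convex combination `(1 - a) H + a K` of two probability measures. -/
def mix (a : Set.Ioo (0 : ℝ) 1) (H K : ProbabilityMeasure Θ) : ProbabilityMeasure Θ :=
  ⟨ENNReal.ofReal (1 - (a : ℝ)) • (H : Measure Θ) + ENNReal.ofReal (a : ℝ) • (K : Measure Θ), ⟨by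
    simp only [Measure.add_apply, Measure.smul_apply, measure_univ, smul_eq_mul, mul_one]
    rw [← ENNReal.ofReal_add (by linarith [a.2.2]) a.2.1.le]
    simp⟩⟩

/-- Newton's recursive rule along the sequence of observations `x 1, x 2, …`:
`G_0` is given and `G_n = (1 - α_n) G_{n-1} + α_n P_{G_{n-1}}(· ∣ x_n)` for `n ≥ 1`. -/
def newtonRule (f : 𝕏 → Θ → ℝ≥0) (G0 : ProbabilityMeasure Θ) (α : ℕ → Set.Ioo (0 : ℝ) 1)
    (x : ℕ → 𝕏) : ℕ → ProbabilityMeasure Θ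
  | 0 => G0
  | n + 1 => mix (α (n + 1)) (newtonRule f G0 α x n)
      (bayesUpdate f (newtonRule f G0 α x n) (x (n + 1)))

/-- The mixing distribution `G`: the weak limit of `G_n` along the sequence of observations. -/
def limitMixing [TopologicalSpace Θ] [OpensMeasurableSpace Θ]
    (f : 𝕏 → Θ → ℝ≥0) (G0 : ProbabilityMeasure Θ) (α : ℕ → Set.Ioo (0 : ℝ) 1)
    (x : ℕ → 𝕏) : ProbabilityMeasure Θ :=
  @limUnder _ _ _ ⟨G0⟩ atTop (newtonRule f G0 α x)

/-- `∫_𝕏 P_H(A ∣ x)² dF_H(x) - H(A)²`; at `H = G_n` this is the plug-in variance `V_{A,n}`. -/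
def plugInVariance (μ : Measure 𝕏) (f : 𝕏 → Θ → ℝ≥0) (A : Set Θ)
    (H : ProbabilityMeasure Θ) : ℝ :=
  ∫ x, (bayesUpdate f H x : Measure Θ).real A ^ 2 ∂(mixLaw μ f H) - (H : Measure Θ).real A ^ 2

/-- `∫_{f_H ≠ 0} P_H(A ∣ x)² dF_H(x) - H(A)²`; at `H = G` this is the limit variance `V_A`. -/
def limitVariance (μ : Measure 𝕏) (f : 𝕏 → Θ → ℝ≥0) (A : Set Θ)
    (H : ProbabilityMeasure Θ) : ℝ :=
  ∫ x in {x | mixDensity f H x ≠ 0},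
    (bayesUpdate f H x : Measure Θ).real A ^ 2 ∂(mixLaw μ f H) - (H : Measure Θ).real A ^ 2

/-- The sequence of observations `k ↦ Z_k(ω)` (only the indices `k ≥ 1` matter). -/
def path {S : Type*} (Z : ℕ → Ω → S) (ω : Ω) : ℕ → S := fun k => Z k ω

/-- The vector `Z_{1:n} = (Z_1, …, Z_n)`. -/
def upTo {S : Type*} (Z : ℕ → Ω → S) (n : ℕ) (ω : Ω) : Fin n → S := fun i => Z (i + 1) ω

/-- The process `((X_n, θ_n))_{n ≥ 1}` has a law consistent with Newton's learning rule:
`X_n ∣ X_{1:n-1}, θ_{1:n} ∼ f(· ∣ θ_n)` for `n ≥ 1`, `θ_1 ∼ G_0`, and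
`θ_{n+1} ∣ X_{1:n} ∼ G_n` for `n ≥ 1` (the case `n = 0` of `cond_param` says `θ_1 ∼ G_0`). -/
structure IsNewtonModel [StandardBorelSpace 𝕏] [Nonempty 𝕏] [StandardBorelSpace Θ] [Nonempty Θ]
    (μ : Measure 𝕏) (f : 𝕏 → Θ → ℝ≥0) (G0 : ProbabilityMeasure Θ)
    (α : ℕ → Set.Ioo (0 : ℝ) 1) (P : Measure Ω) [IsFiniteMeasure P]
    (X : ℕ → Ω → 𝕏) (θ : ℕ → Ω → Θ) : Prop where
  measurable_obs : ∀ n, 1 ≤ n → Measurable (X n)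
  measurable_param : ∀ n, 1 ≤ n → Measurable (θ n)
  cond_obs : ∀ n : ℕ, ∀ᵐ ω ∂P,
    condDistrib (X (n + 1)) (fun ω => (upTo X n ω, upTo θ (n + 1) ω)) P
      (upTo X n ω, upTo θ (n + 1) ω) = μ.withDensity (fun x => (f x (θ (n + 1) ω) : ℝ≥0∞))
  cond_param : ∀ n : ℕ, ∀ᵐ ω ∂P,
    condDistrib (θ (n + 1)) (upTo X n) P (upTo X n ω)
      = (newtonRule f G0 α (path X ω) n : Measure Θ)

/-- For almost every `ω` with `V_A(ω) > 0`, the conditional law of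
`√r_n (G(A) - G_n(A)) / √V_{A,n}` given `X_{1:n}` converges to `N(0,1)`
(convergence of the distribution functions at every point). -/
def CondGaussianLimit [TopologicalSpace Θ] [OpensMeasurableSpace Θ]
    (μ : Measure 𝕏) (f : 𝕏 → Θ → ℝ≥0) (G0 : ProbabilityMeasure Θ)
    (α : ℕ → Set.Ioo (0 : ℝ) 1) (P : Measure Ω) [IsFiniteMeasure P] (X : ℕ → Ω → 𝕏)
    (r : ℕ → ℝ) (A : Set Θ) : Prop :=
  ∀ᵐ ω ∂P, 0 < limitVariance μ f A (limitMixing f G0 α (path X ω)) →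
    ∀ t : ℝ, Tendsto
      (fun n : ℕ =>
        (condDistrib
          (fun ω' => √(r n) *
            (((limitMixing f G0 α (path X ω') : Measure Θ).real A
                - (newtonRule f G0 α (path X ω') n : Measure Θ).real A)
              / √(plugInVariance μ f A (newtonRule f G0 α (path X ω') n))))
          (upTo X n) P (upTo X n ω)).real (Set.Iic t))
      atTop (𝓝 (cdf (gaussianReal 0 1) t))

/-- For almost every `ω` with `V_A(ω) > 0`, for every `γ ∈ (0,1)`, the interval with endpoints
`G_n(A) ± z_{1-γ/2} √(V_{A,n} / r_n)` has asymptotic conditional probability `1 - γ` of containing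
`G(A)`, given `X_{1:n}`; here `z` is the `(1 - γ/2)`-quantile of `N(0,1)`. -/
def AsymptoticCredibleInterval [TopologicalSpace Θ] [OpensMeasurableSpace Θ]
    (μ : Measure 𝕏) (f : 𝕏 → Θ → ℝ≥0) (G0 : ProbabilityMeasure Θ)
    (α : ℕ → Set.Ioo (0 : ℝ) 1) (P : Measure Ω) [IsFiniteMeasure P] (X : ℕ → Ω → 𝕏)
    (r : ℕ → ℝ) (A : Set Θ) : Prop :=
  ∀ᵐ ω ∂P, 0 < limitVariance μ f A (limitMixing f G0 α (path X ω)) →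
    ∀ γ z : ℝ, 0 < γ → γ < 1 → cdf (gaussianReal 0 1) z = 1 - γ / 2 →
      Tendsto
        (fun n : ℕ =>
          (condDistrib (fun ω' => (limitMixing f G0 α (path X ω') : Measure Θ).real A)
            (upTo X n) P (upTo X n ω)).real
            (Set.Ioo
              ((newtonRule f G0 α (path X ω) n : Measure Θ).real A
                - z * √(plugInVariance μ f A (newtonRule f G0 α (path X ω) n) / r n))
              ((newtonRule f G0 α (path X ω) n : Measure Θ).real A
                + z * √(plugInVariance μ f A (newtonRule f G0 α (path X ω) n) / r n))))
        atTop (𝓝 (1 - γ))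

end NewtonMixture

end

/-! Fix a measurable set `A`. Given `X_{1:n}`, the parameter `θ_{n+1}` has law `G_n`, so `X_{n+1}`
has law `F_{G_n}`, and averaging the posterior over this law gives back `G_n`. Hence `M_n = G_n(A)`
is a `[0,1]`-valued martingale whose increments `α_{n+1} (P_{G_n}(A ∣ X_{n+1}) - G_n(A))` are
bounded by `α_{n+1}` and have conditional variance `α_{n+1}² V_{A,n}`. So `G_n(A)` converges almost
surely for each `A`. Since all the means equal `G_0(A)`, no mass is lost in the limit, and
`exists_kernel_forall_ae_tendsto` assembles the limits into a random probability measure `G`.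
Convergence on a countable π-system gives weak convergence. Setwise convergence also gives Fatou
inequalities for the posterior masses, and a one-sided Scheffé lemma turns them into `V_{A,n} → V_A`
(`tendsto_plugInVariance`).

The central limit theorem is proved through conditional characteristic functions. Write `V_k` for
`V_{A,k}`, freeze `λ` and `V_n` at time `n`, and let `U_k = exp(iλ(M_{n+k} - M_n)) exp(λ² V_n S_k /
2)` with `S_k` the sum of the first `k` squared weights after `n`. By a Taylor expansion its
increments are martingale differences up to errors of order `λ² α² |V_{n+k} - V_n|` and `|λ|³ α³`.
Summing and letting `k → ∞` (`norm_condExp_exp_sub_one_le`), with `s_n = ∑_{k>n} α_k²`, shows that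
`E[exp(iλ(G(A) - G_n(A))) ∣ X_{1:n}] exp(λ² V_n s_n / 2)` is `1` up to `λ² s_n` times the
conditional mean of the oscillation of `V` after `n`, plus `|λ|³ s_n sup α`.

Now take `λ = t √(r_n / V_n)`. As `r_n s_n → 1`, the first error vanishes by a case of Hunt's lemma
(`ae_tendsto_condExp_tailOscillation`) and the second because `√r_n sup α → 0`. The limit is
`exp(-t²/2)` almost surely on `V_A > 0`; a single null set suffices by using rational `t` and
countably many truncation levels of `V_n`. Lévy's continuity theorem gives (a), and (b) is the same
limit evaluated on `(-z, z)`. For polynomial weights the tail sums are compared with the increments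
of a primitive. -/

noncomputable section

namespace NewtonMixture

set_option linter.unusedSectionVars false

/-! ### Random limit measures from setwise almost sure convergence. -/

section LimitKernel

variable {Ω Θ : Type*} [MeasurableSpace Ω] [MeasurableSpace Θ]

/-- For a sequence of random measures with constant mean, the lower limits of the masses of sets
decreasing to the empty set tend to `0` almost surely. -/
lemma ae_tendsto_liminf_zero_of_antitone (P : Measure Ω) (K : ℕ → Kernel Ω Θ)
    (ν : Measure Θ) [IsFiniteMeasure ν]
    (hint : ∀ n A, MeasurableSet A → ∫⁻ ω, K n ω A ∂P = ν A)
    (A : ℕ → Set Θ) (hA : ∀ k, MeasurableSet (A k)) (hanti : Antitone A) (hempty : ⋂ k, A k = ∅) :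
    ∀ᵐ ω ∂P, Tendsto (fun k => liminf (fun n => K n ω (A k)) atTop) atTop (𝓝 0) := by
  set L : ℕ → Ω → ℝ≥0∞ := fun k ω => liminf (fun n => K n ω (A k)) atTop with hL
  have hLm : ∀ k, Measurable (L k) := fun k =>
    Measurable.liminf fun n => (K n).measurable_coe (hA k)
  have hLanti : ∀ ω, Antitone fun k => L k ω := fun ω i j hij =>
    liminf_le_liminf (Eventually.of_forall fun n => measure_mono (hanti hij))
  -- Fatou's lemma together with the constant mean; this replaces the uniform integrability that
  -- setwise limits would otherwise need.
  have hle : ∀ k, ∫⁻ ω, L k ω ∂P ≤ ν (A k) := fun k => by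
    refine (lintegral_liminf_le fun n => (K n).measurable_coe (hA k)).trans ?_
    simp [hint _ _ (hA k)]
  have hν : Tendsto (fun k => ν (A k)) atTop (𝓝 0) := by
    have := tendsto_measure_iInter_atTop (μ := ν) (fun k => (hA k).nullMeasurableSet) hanti
      ⟨0, measure_ne_top _ _⟩
    simpa [hempty, Function.comp_def] using this
  have h0 : ∫⁻ ω, ⨅ k, L k ω ∂P = 0 := by
    refine le_antisymm (ge_of_tendsto' hν fun k => ?_) zero_le
    exact (lintegral_mono fun ω => iInf_le _ k).trans (hle k)
  rw [lintegral_eq_zero_iff (Measurable.iInf hLm)] at h0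
  filter_upwards [h0] with ω hω
  have := tendsto_atTop_iInf (hLanti ω)
  rwa [show ⨅ k, L k ω = 0 from hω] at this

/-- A sequence of random probability measures with constant mean whose masses converge almost
surely on every measurable set has a limit random probability measure. -/
theorem exists_kernel_forall_ae_tendsto [StandardBorelSpace Θ] [Nonempty Θ]
    (P : Measure Ω) (K : ℕ → Kernel Ω Θ)
    [∀ n, IsMarkovKernel (K n)] (ν : Measure Θ) [IsFiniteMeasure ν]
    (hlim : ∀ A, MeasurableSet A → ∀ᵐ ω ∂P, ∃ c, Tendsto (fun n => K n ω A) atTop (𝓝 c))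
    (hint : ∀ n A, MeasurableSet A → ∫⁻ ω, K n ω A ∂P = ν A) :
    ∃ L : Kernel Ω Θ, IsMarkovKernel L ∧ ∀ A, MeasurableSet A →
      ∀ᵐ ω ∂P, Tendsto (fun n => K n ω A) atTop (𝓝 (L ω A)) := by
  -- The lower limit exists for every `ω`, and is measurable in `ω` and monotone in `A` without
  -- exception. Only additivity needs true limits, and it holds outside a null set depending on the
  -- pair of sets.
  set M : Set Θ → Ω → ℝ≥0∞ := fun A ω => liminf (fun n => K n ω A) atTop with hM
  have hMlim : ∀ A, MeasurableSet A → ∀ᵐ ω ∂P, Tendsto (fun n => K n ω A) atTop (𝓝 (M A ω)) := by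
    intro A hA
    filter_upwards [hlim A hA] with ω ⟨c, hc⟩
    rwa [show M A ω = c from hc.liminf_eq]
  have hMle : ∀ A ω, M A ω ≤ 1 := fun A ω => by
    refine (liminf_le_liminf (Eventually.of_forall fun n => prob_le_one)).trans ?_
    simp
  have hMtop : ∀ A ω, M A ω ≠ ∞ := fun A ω => ne_top_of_le_ne_top (by simp) (hMle A ω)
  have hMmono : ∀ A B ω, A ⊆ B → M A ω ≤ M B ω := fun A B ω h =>
    liminf_le_liminf (Eventually.of_forall fun n => measure_mono h)
  have hMadd : ∀ A B, MeasurableSet A → MeasurableSet B → Disjoint A B →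
      ∀ᵐ ω ∂P, M (A ∪ B) ω = M A ω + M B ω := by
    intro A B hA hB hAB
    filter_upwards [hMlim A hA, hMlim B hB, hMlim (A ∪ B) (hA.union hB)] with ω h1 h2 h3
    refine tendsto_nhds_unique h3 ?_
    simpa only [measure_union hAB hB] using h1.add h2
  have hMm : ∀ A, MeasurableSet A → Measurable (M A) := fun A hA =>
    Measurable.liminf fun n => (K n).measurable_coe hA
  have hMzero : ∀ A : ℕ → Set Θ, (∀ k, MeasurableSet (A k)) → Antitone A → ⋂ k, A k = ∅ →
      ∀ᵐ ω ∂P, Tendsto (fun k => M (A k) ω) atTop (𝓝 0) := fun A h1 h2 h3 =>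
    ae_tendsto_liminf_zero_of_antitone P K ν hint A h1 h2 h3
  have hMuniv : ∀ ω, M Set.univ ω = 1 := fun ω => by simp [hM]
  -- On the real line a measure is determined by its distribution function at the rationals, so
  -- countably many null sets suffice to build the limit.
  set e : Θ → ℝ := embeddingReal Θ with he
  have hem : MeasurableEmbedding e := measurableEmbedding_embeddingReal Θ
  have hpre : ∀ {B : Set ℝ}, MeasurableSet B → MeasurableSet (e ⁻¹' B) := fun h =>
    hem.measurable h
  set F : Ω → ℚ → ℝ := fun ω q => (M (e ⁻¹' Set.Iic (q : ℝ)) ω).toReal with hF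
  have hFm : Measurable F := by
    refine measurable_pi_iff.2 fun q => (hMm _ (hpre measurableSet_Iic)).ennreal_toReal
  have hF01 : ∀ ω q, 0 ≤ F ω q ∧ F ω q ≤ 1 := fun ω q =>
    ⟨ENNReal.toReal_nonneg, ENNReal.toReal_le_of_le_ofReal zero_le_one (by simpa using hMle _ _)⟩
  have hFmono : ∀ ω, Monotone (F ω) := fun ω p q hpq =>
    ENNReal.toReal_mono (hMtop _ _) (hMmono _ _ _ (Set.preimage_mono
      (Set.Iic_subset_Iic.2 (by exact_mod_cast hpq))))
  have hbot : ∀ᵐ ω ∂P, Tendsto (F ω) atBot (𝓝 0) := by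
    have := hMzero (fun k : ℕ => e ⁻¹' Set.Iic (-(k : ℝ))) (fun k => hpre measurableSet_Iic)
      (fun i j hij => Set.preimage_mono (Set.Iic_subset_Iic.2 (by
        simpa using hij))) (by
        ext θ
        simp only [Set.mem_iInter, Set.mem_preimage, Set.mem_Iic, Set.mem_empty_iff_false,
          iff_false, not_forall, not_le]
        obtain ⟨k, hk⟩ := exists_nat_gt (-e θ)
        exact ⟨k, by linarith⟩)
    filter_upwards [this] with ω hω
    have h1 : Tendsto (fun k : ℕ => F ω (-(k : ℚ))) atTop (𝓝 0) := by
      have := (ENNReal.tendsto_toReal ENNReal.zero_ne_top).comp hω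
      simpa [hF, Function.comp_def] using this
    have h2 := tendsto_atBot_ciInf (hFmono ω) ⟨0, by rintro _ ⟨q, rfl⟩; exact (hF01 ω q).1⟩
    have h3 : Tendsto (fun k : ℕ => -(k : ℚ)) atTop atBot :=
      tendsto_neg_atTop_atBot.comp tendsto_natCast_atTop_atTop
    rwa [tendsto_nhds_unique (h2.comp h3) h1] at h2
  have htop : ∀ᵐ ω ∂P, Tendsto (F ω) atTop (𝓝 1) := by
    have := hMzero (fun k : ℕ => e ⁻¹' Set.Ioi (k : ℝ)) (fun k => hpre measurableSet_Ioi)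
      (fun i j hij => Set.preimage_mono (Set.Ioi_subset_Ioi (by simpa using hij))) (by
        ext θ
        simp only [Set.mem_iInter, Set.mem_preimage, Set.mem_Ioi, Set.mem_empty_iff_false,
          iff_false, not_forall, not_lt]
        exact exists_nat_ge (e θ))
    have hadd : ∀ᵐ ω ∂P, ∀ k : ℕ, M (e ⁻¹' Set.Iic (k : ℝ)) ω + M (e ⁻¹' Set.Ioi (k : ℝ)) ω = 1 := by
      rw [ae_all_iff]
      intro k
      filter_upwards [hMadd (e ⁻¹' Set.Iic (k : ℝ)) (e ⁻¹' Set.Ioi (k : ℝ)) (hpre measurableSet_Iic)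
        (hpre measurableSet_Ioi) (Disjoint.preimage _ (Set.Iic_disjoint_Ioi le_rfl))] with ω hω
      rw [← hω, ← Set.preimage_union, Set.Iic_union_Ioi, Set.preimage_univ, hMuniv]
    filter_upwards [this, hadd] with ω hω ha
    have h1 : Tendsto (fun k : ℕ => F ω (k : ℚ)) atTop (𝓝 1) := by
      have h := (ENNReal.tendsto_toReal ENNReal.zero_ne_top).comp hω
      have h' := (tendsto_const_nhds (x := (1 : ℝ))).sub h
      simp only [ENNReal.toReal_zero, sub_zero] at h'
      refine h'.congr fun k => ?_
      have := congrArg ENNReal.toReal (ha k)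
      rw [ENNReal.toReal_add (hMtop _ _) (hMtop _ _), ENNReal.toReal_one] at this
      simp only [hF, Function.comp_apply, Rat.cast_natCast]
      linarith
    have h2 := tendsto_atTop_ciSup (hFmono ω) ⟨1, by rintro _ ⟨q, rfl⟩; exact (hF01 ω q).2⟩
    rwa [tendsto_nhds_unique (h2.comp tendsto_natCast_atTop_atTop) h1] at h2
  have hright : ∀ᵐ ω ∂P, ∀ q : ℚ, ⨅ r : Set.Ioi q, F ω r = F ω q := by
    rw [ae_all_iff]
    intro q
    -- The intervals `(q, q + 1/(k+1)]` decrease to the empty set, so right continuity at `q` is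
    -- again continuity at `∅`, like the two limits at infinity.
    set A : ℕ → Set Θ := fun k => e ⁻¹' Set.Ioc (q : ℝ) (q + 1 / ((k : ℝ) + 1)) with hA
    have h0 := hMzero A (fun k => hpre measurableSet_Ioc)
      (fun i j hij => Set.preimage_mono (Set.Ioc_subset_Ioc_right (by
        gcongr))) (by
        ext θ
        simp only [hA, Set.mem_iInter, Set.mem_preimage, Set.mem_Ioc, Set.mem_empty_iff_false,
          iff_false, not_forall, not_and, not_le]
        by_cases h : (q : ℝ) < e θ
        · obtain ⟨k, hk⟩ := exists_nat_one_div_lt (sub_pos.2 h)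
          exact ⟨k, fun _ => by linarith⟩
        · exact ⟨0, fun h' => absurd h' h⟩)
    have hadd : ∀ᵐ ω ∂P, ∀ k : ℕ, M (e ⁻¹' Set.Iic (q + 1 / ((k : ℝ) + 1))) ω
        = M (e ⁻¹' Set.Iic (q : ℝ)) ω + M (A k) ω := by
      rw [ae_all_iff]
      intro k
      filter_upwards [hMadd (e ⁻¹' Set.Iic (q : ℝ)) (A k) (hpre measurableSet_Iic)
        (hpre measurableSet_Ioc) (Disjoint.preimage _ (Set.disjoint_left.2 fun x h1 h2 =>
          not_lt.2 h1 h2.1))] with ω hω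
      rw [← hω, hA, ← Set.preimage_union, Set.Iic_union_Ioc_eq_Iic]
      have : (0 : ℝ) < 1 / ((k : ℝ) + 1) := by positivity
      linarith
    filter_upwards [h0, hadd] with ω h0 ha
    have hbdd : BddBelow (Set.range fun r : Set.Ioi q => F ω r) :=
      ⟨0, by rintro _ ⟨r, rfl⟩; exact (hF01 ω r).1⟩
    have : Nonempty (Set.Ioi q) := ⟨⟨q + 1, by simp⟩⟩
    refine le_antisymm ?_ (le_ciInf fun r => hFmono ω (le_of_lt r.2))
    have h1 : Tendsto (fun k : ℕ => F ω q + (M (A k) ω).toReal) atTop (𝓝 (F ω q)) := by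
      simpa using ((ENNReal.tendsto_toReal ENNReal.zero_ne_top).comp h0).const_add (F ω q)
    refine ge_of_tendsto' h1 fun k => ?_
    have hpos : (0 : ℚ) < 1 / ((k : ℚ) + 1) := by positivity
    refine (ciInf_le hbdd ⟨q + 1 / ((k : ℚ) + 1), by simpa using hpos⟩).trans_eq ?_
    simp only [hF]
    rw [← ENNReal.toReal_add (hMtop _ _) (hMtop _ _), ← ha k]
    norm_num
  have hgood : ∀ᵐ ω ∂P, IsRatStieltjesPoint F ω := by
    filter_upwards [hbot, htop, hright] with ω h1 h2 h3
    exact ⟨hFmono ω, h2, h1, h3⟩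
  -- `toRatCDF` substitutes a default distribution function outside the good event, so `N` is a
  -- Markov kernel for every `ω`.
  have hcdf := isMeasurableRatCDF_toRatCDF hFm
  let N : Kernel Ω ℝ := ⟨fun ω => (hcdf.stieltjesFunction ω).measure,
    hcdf.measurable_measure_stieltjesFunction⟩
  have hNprob : IsMarkovKernel N := ⟨fun ω => hcdf.instIsProbabilityMeasure_stieltjesFunction ω⟩
  -- The null set depends on `B`, and `M` need not be a measure for any `ω`; the π-λ induction is
  -- therefore run on almost sure equalities.
  have hN : ∀ B : Set ℝ, MeasurableSet B → ∀ᵐ ω ∂P, M (e ⁻¹' B) ω = N ω B := by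
    intro B hB
    induction B, hB using MeasurableSpace.induction_on_inter Real.borel_eq_generateFrom_Iic_rat
      Real.isPiSystem_Iic_rat with
    | empty => exact ae_of_all _ fun ω => by simp [hM]
    | basic t ht =>
      obtain ⟨q, rfl⟩ : ∃ q : ℚ, Set.Iic (q : ℝ) = t := by simpa using ht
      filter_upwards [hgood] with ω hω
      change _ = (hcdf.stieltjesFunction ω).measure _
      rw [hcdf.measure_stieltjesFunction_Iic, hcdf.stieltjesFunction_eq,
        toRatCDF_of_isRatStieltjesPoint hω, hF, ENNReal.ofReal_toReal (hMtop _ _)]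
    | compl t ht ih =>
      have ht' : MeasurableSet t := ht
      filter_upwards [ih, hMadd (e ⁻¹' t) (e ⁻¹' tᶜ) (hpre ht') (hpre ht'.compl)
        (Disjoint.preimage _ disjoint_compl_right)] with ω h1 h2
      rw [← Set.preimage_union, Set.union_compl_self, Set.preimage_univ, hMuniv, h1] at h2
      rw [prob_compl_eq_one_sub ht', h2, ENNReal.add_sub_cancel_left (measure_ne_top _ _)]
    | iUnion t hd ht ih =>
      have ht' : ∀ i, MeasurableSet (t i) := ht
      -- Finite unions are handled by additivity. The remainders decrease to the empty set, so their
      -- masses vanish by `hMzero`; this is where countable additivity comes from.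
      set U : ℕ → Set ℝ := Set.accumulate t with hU
      have hUm : ∀ k, MeasurableSet (U k) := fun k =>
        MeasurableSet.biUnion (Set.to_countable _) fun i _ => ht' i
      have hUsub : ∀ k, U k ⊆ ⋃ i, t i := fun k => Set.accumulate_subset_iUnion k
      have hfin : ∀ k, ∀ᵐ ω ∂P, M (e ⁻¹' U k) ω = N ω (U k) := by
        intro k
        induction k with
        | zero => simpa [hU, Set.accumulate_zero_nat] using ih 0
        | succ k ihk =>
          have hdis : Disjoint (U k) (t (k + 1)) := by
            rw [hU, Set.accumulate_def]
            simp only [Set.disjoint_iUnion_left]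
            intro i hi
            exact hd (by omega)
          have hsucc : U (k + 1) = U k ∪ t (k + 1) := Set.accumulate_succ t k
          filter_upwards [ihk, ih (k + 1), hMadd (e ⁻¹' U k) (e ⁻¹' t (k + 1)) (hpre (hUm k))
            (hpre (ht' _)) (Disjoint.preimage _ hdis)] with ω h1 h2 h3
          rw [hsucc, Set.preimage_union, h3, h1, h2, measure_union hdis (ht' _)]
      have hUall : MeasurableSet (⋃ i, t i) := MeasurableSet.iUnion ht'
      have h0 := hMzero (fun k => e ⁻¹' ((⋃ i, t i) \ U k)) (fun k => hpre (hUall.diff (hUm k)))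
        (fun i j hij => Set.preimage_mono (Set.sdiff_subset_sdiff_right
          (Set.monotone_accumulate hij))) (by
          rw [← Set.preimage_iInter, ← Set.sdiff_iUnion, hU, Set.iUnion_accumulate]
          simp)
      have hadd : ∀ᵐ ω ∂P, ∀ k, M (e ⁻¹' ⋃ i, t i) ω
          = M (e ⁻¹' U k) ω + M (e ⁻¹' ((⋃ i, t i) \ U k)) ω := by
        rw [ae_all_iff]
        intro k
        filter_upwards [hMadd (e ⁻¹' U k) (e ⁻¹' ((⋃ i, t i) \ U k)) (hpre (hUm k))
          (hpre (hUall.diff (hUm k))) (Disjoint.preimage _ Set.disjoint_sdiff_right)] with ω hω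
        rw [← hω, ← Set.preimage_union, Set.union_sdiff_cancel (hUsub k)]
      filter_upwards [h0, hadd, ae_all_iff.2 hfin] with ω h0 ha hf
      have h1 : Tendsto (fun k => N ω (U k)) atTop (𝓝 (N ω (⋃ i, t i))) :=
        tendsto_measure_iUnion_accumulate
      have h2 := h1.add h0
      rw [add_zero] at h2
      refine tendsto_nhds_unique (tendsto_const_nhds.congr fun k => ?_) h2
      rw [ha k, hf k]
  -- A measurable left inverse of the embedding, defined on all of `ℝ`: pushing `N` forward by it
  -- gives a Markov kernel without discussing the range of `e`.
  obtain ⟨g, hgm, hg⟩ := hem.exists_measurable_extend measurable_id (fun _ => ‹Nonempty Θ›)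
  refine ⟨N.map g, Kernel.IsMarkovKernel.map N hgm, fun A hA => ?_⟩
  filter_upwards [hMlim A hA, hN (g ⁻¹' A) (hgm hA)] with ω h1 h2
  rw [← Set.preimage_comp, hg, Set.preimage_id] at h2
  rwa [Kernel.map_apply' _ hgm _ hA, ← h2]

end LimitKernel

/-! ### Bayes updates and mixture laws: measurability and moments. -/

section Update

variable {𝕏 Θ S : Type*} [MeasurableSpace 𝕏] [MeasurableSpace Θ] [MeasurableSpace S]

/-- The unnormalised posterior mass `∫_A f(x ∣ θ) dH(θ)`. -/
def posteriorMass (f : 𝕏 → Θ → ℝ≥0) (H : ProbabilityMeasure Θ) (A : Set Θ) (x : 𝕏) : ℝ≥0∞ :=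
  ∫⁻ θ in A, (f x θ : ℝ≥0∞) ∂(H : Measure Θ)

lemma posteriorMass_univ (f : 𝕏 → Θ → ℝ≥0) (H : ProbabilityMeasure Θ) (x : 𝕏) :
    posteriorMass f H Set.univ x = mixDensity f H x := by
  rw [posteriorMass, Measure.restrict_univ, mixDensity]

lemma posteriorMass_le_mixDensity (f : 𝕏 → Θ → ℝ≥0) (H : ProbabilityMeasure Θ) (A : Set Θ)
    (x : 𝕏) : posteriorMass f H A x ≤ mixDensity f H x :=
  setLIntegral_le_lintegral _ _

lemma bayesUpdate_eq_self (f : 𝕏 → Θ → ℝ≥0) (H : ProbabilityMeasure Θ) {x : 𝕏}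
    (h : ¬(mixDensity f H x ≠ 0 ∧ mixDensity f H x ≠ ∞)) : bayesUpdate f H x = H :=
  dif_neg h

lemma coe_bayesUpdate_of_ne (f : 𝕏 → Θ → ℝ≥0) (H : ProbabilityMeasure Θ) {x : 𝕏}
    (h : mixDensity f H x ≠ 0 ∧ mixDensity f H x ≠ ∞) :
    (bayesUpdate f H x : Measure Θ)
      = (mixDensity f H x)⁻¹ • (H : Measure Θ).withDensity (fun θ => (f x θ : ℝ≥0∞)) :=
  congrArg (fun K : ProbabilityMeasure Θ => (K : Measure Θ)) (dif_pos h)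

lemma bayesUpdate_apply_of_ne (f : 𝕏 → Θ → ℝ≥0) (H : ProbabilityMeasure Θ) {A : Set Θ}
    (hA : MeasurableSet A) {x : 𝕏} (h : mixDensity f H x ≠ 0 ∧ mixDensity f H x ≠ ∞) :
    (bayesUpdate f H x : Measure Θ) A = (mixDensity f H x)⁻¹ * posteriorMass f H A x := by
  rw [coe_bayesUpdate_of_ne f H h, Measure.smul_apply, withDensity_apply _ hA, smul_eq_mul, posteriorMass]

/-- Where `f_H` vanishes, so does the posterior mass it dominates; only the value `∞` has to be
excluded. The product form avoids the case split of `bayesUpdate` in integrals against `mixLaw`. -/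
lemma bayesUpdate_apply_mul (f : 𝕏 → Θ → ℝ≥0) (H : ProbabilityMeasure Θ) {A : Set Θ}
    (hA : MeasurableSet A) {x : 𝕏} (h : mixDensity f H x ≠ ∞) :
    (bayesUpdate f H x : Measure Θ) A * mixDensity f H x = posteriorMass f H A x := by
  by_cases h0 : mixDensity f H x = 0
  · rw [h0, mul_zero]
    exact (le_antisymm (h0 ▸ posteriorMass_le_mixDensity f H A x) zero_le).symm
  · rw [bayesUpdate_apply_of_ne f H hA ⟨h0, h⟩, mul_right_comm, ENNReal.inv_mul_cancel h0 h, one_mul]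

/-- An integral against the kernel `s ↦ H s` restricted to `A`. The parameter `s` is needed because
`H` will be a function of the observations or of `ω`; the constant case uses a one-point space. -/
lemma measurable_posteriorMass {f : 𝕏 → Θ → ℝ≥0} (hf : Measurable (Function.uncurry f))
    {H : S → ProbabilityMeasure Θ} (hH : Measurable fun s => (H s : Measure Θ)) {A : Set Θ}
    (hA : MeasurableSet A) : Measurable fun p : S × 𝕏 => posteriorMass f (H p.1) A p.2 := by
  let κ : Kernel S Θ := ⟨fun s => (H s : Measure Θ), hH⟩
  have : IsMarkovKernel κ := ⟨fun s => (H s).2⟩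
  have hm : Measurable fun q : (S × 𝕏) × Θ => (f q.1.2 q.2 : ℝ≥0∞) :=
    (hf.comp ((measurable_snd.comp measurable_fst).prodMk measurable_snd)).coe_nnreal_ennreal
  exact hm.lintegral_kernel_prod_right' (κ := (κ.restrict hA).prodMkRight 𝕏)

lemma measurable_mixDensity_prod {f : 𝕏 → Θ → ℝ≥0} (hf : Measurable (Function.uncurry f))
    {H : S → ProbabilityMeasure Θ} (hH : Measurable fun s => (H s : Measure Θ)) :
    Measurable fun p : S × 𝕏 => mixDensity f (H p.1) p.2 := by
  simpa only [posteriorMass_univ] using measurable_posteriorMass hf hH MeasurableSet.univ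

lemma measurable_mixDensity {f : 𝕏 → Θ → ℝ≥0} (hf : Measurable (Function.uncurry f))
    (H : ProbabilityMeasure Θ) : Measurable (mixDensity f H) :=
  (measurable_mixDensity_prod hf (H := fun _ : Unit => H) measurable_const).comp
    (measurable_const.prodMk measurable_id : Measurable fun x => ((), x))

lemma measurable_bayesUpdate {f : 𝕏 → Θ → ℝ≥0} (hf : Measurable (Function.uncurry f))
    {H : S → ProbabilityMeasure Θ} (hH : Measurable fun s => (H s : Measure Θ)) :
    Measurable fun p : S × 𝕏 => (bayesUpdate f (H p.1) p.2 : Measure Θ) := by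
  classical
  refine Measure.measurable_of_measurable_coe _ fun A hA => ?_
  have hd := measurable_mixDensity_prod hf hH
  have h : (fun p : S × 𝕏 => (bayesUpdate f (H p.1) p.2 : Measure Θ) A) = fun p =>
      if mixDensity f (H p.1) p.2 ≠ 0 ∧ mixDensity f (H p.1) p.2 ≠ ∞ then
        (mixDensity f (H p.1) p.2)⁻¹ * posteriorMass f (H p.1) A p.2
      else (H p.1 : Measure Θ) A := by
    ext p
    split_ifs with h
    · exact bayesUpdate_apply_of_ne f _ hA h
    · rw [bayesUpdate_eq_self f _ h]
  rw [h]
  refine Measurable.ite ?_ (hd.inv.mul (measurable_posteriorMass hf hH hA))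
    (((Measure.measurable_coe hA).comp hH).comp measurable_fst)
  exact ((measurableSet_singleton (0 : ℝ≥0∞)).compl.inter
    (measurableSet_singleton (∞ : ℝ≥0∞)).compl).preimage hd

lemma mix_apply (a : Set.Ioo (0 : ℝ) 1) (H K : ProbabilityMeasure Θ) (A : Set Θ) :
    (mix a H K : Measure Θ) A = ENNReal.ofReal (1 - (a : ℝ)) * (H : Measure Θ) A
      + ENNReal.ofReal (a : ℝ) * (K : Measure Θ) A := rfl

lemma mix_real_apply (a : Set.Ioo (0 : ℝ) 1) (H K : ProbabilityMeasure Θ) (A : Set Θ) :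
    (mix a H K : Measure Θ).real A = (1 - (a : ℝ)) * (H : Measure Θ).real A
      + a * (K : Measure Θ).real A := by
  rw [measureReal_def, mix_apply, ENNReal.toReal_add (by finiteness) (by finiteness),
    ENNReal.toReal_mul, ENNReal.toReal_mul, ENNReal.toReal_ofReal (by linarith [a.2.2]),
    ENNReal.toReal_ofReal a.2.1.le]
  rfl

/-- Newton's rule as a function of the finite vector of observations. -/
def finiteRule (f : 𝕏 → Θ → ℝ≥0) (G0 : ProbabilityMeasure Θ) (α : ℕ → Set.Ioo (0 : ℝ) 1) :
    (n : ℕ) → (Fin n → 𝕏) → ProbabilityMeasure Θ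
  | 0, _ => G0
  | n + 1, v => mix (α (n + 1)) (finiteRule f G0 α n (Fin.init v))
      (bayesUpdate f (finiteRule f G0 α n (Fin.init v)) (v (Fin.last n)))

/-- Shows that `G_n` depends on the whole path only through `X_{1:n}`, which is what adaptedness and
conditioning require. -/
lemma finiteRule_upTo {Ω : Type*} (f : 𝕏 → Θ → ℝ≥0) (G0 : ProbabilityMeasure Θ)
    (α : ℕ → Set.Ioo (0 : ℝ) 1) (X : ℕ → Ω → 𝕏) (n : ℕ) (ω : Ω) :
    finiteRule f G0 α n (upTo X n ω) = newtonRule f G0 α (path X ω) n := by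
  induction n with
  | zero => rfl
  | succ n ih =>
    have h : Fin.init (upTo X (n + 1) ω) = upTo X n ω := rfl
    rw [finiteRule, h, ih]
    rfl

lemma measurable_init {n : ℕ} : Measurable (Fin.init : (Fin (n + 1) → 𝕏) → Fin n → 𝕏) :=
  measurable_pi_iff.2 fun i => measurable_pi_apply (Fin.castSucc i)

lemma measurable_finiteRule {f : 𝕏 → Θ → ℝ≥0} (hf : Measurable (Function.uncurry f))
    (G0 : ProbabilityMeasure Θ) (α : ℕ → Set.Ioo (0 : ℝ) 1) (n : ℕ) :
    Measurable fun v : Fin n → 𝕏 => (finiteRule f G0 α n v : Measure Θ) := by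
  induction n with
  | zero => exact measurable_const (a := (G0 : Measure Θ))
  | succ n ih =>
    refine Measure.measurable_of_measurable_coe _ fun A hA => ?_
    simp only [finiteRule, mix_apply]
    have h1 := (Measure.measurable_coe hA).comp (ih.comp measurable_init)
    have h2 := (Measure.measurable_coe hA).comp ((measurable_bayesUpdate hf ih).comp
      (measurable_init.prodMk (measurable_pi_apply (Fin.last n))))
    exact (h1.const_mul _).add (h2.const_mul _)

variable {μ : Measure 𝕏} [SigmaFinite μ] {f : 𝕏 → Θ → ℝ≥0}

/-- Tonelli: each `f(· ∣ θ)` integrates to one, so only `H(A)` is left. -/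
lemma lintegral_posteriorMass (hf : Measurable (Function.uncurry f))
    (hf_density : ∀ θ, ∫⁻ x, (f x θ : ℝ≥0∞) ∂μ = 1) (H : ProbabilityMeasure Θ) (A : Set Θ) :
    ∫⁻ x, posteriorMass f H A x ∂μ = (H : Measure Θ) A := by
  simp only [posteriorMass]
  rw [lintegral_lintegral_swap]
  · simp [hf_density]
  · exact hf.coe_nnreal_ennreal.aemeasurable

lemma lintegral_mixDensity (hf : Measurable (Function.uncurry f))
    (hf_density : ∀ θ, ∫⁻ x, (f x θ : ℝ≥0∞) ∂μ = 1) (H : ProbabilityMeasure Θ) :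
    ∫⁻ x, mixDensity f H x ∂μ = 1 := by
  simpa [posteriorMass_univ] using lintegral_posteriorMass hf hf_density H Set.univ

lemma isProbabilityMeasure_mixLaw (hf : Measurable (Function.uncurry f))
    (hf_density : ∀ θ, ∫⁻ x, (f x θ : ℝ≥0∞) ∂μ = 1) (H : ProbabilityMeasure Θ) :
    IsProbabilityMeasure (mixLaw μ f H) :=
  ⟨by rw [mixLaw, withDensity_apply _ MeasurableSet.univ, Measure.restrict_univ,
    lintegral_mixDensity hf hf_density]⟩

lemma ae_mixDensity_ne_top (hf : Measurable (Function.uncurry f))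
    (hf_density : ∀ θ, ∫⁻ x, (f x θ : ℝ≥0∞) ∂μ = 1) (H : ProbabilityMeasure Θ) :
    ∀ᵐ x ∂μ, mixDensity f H x ≠ ∞ := by
  filter_upwards [ae_lt_top (measurable_mixDensity hf H)
    (by rw [lintegral_mixDensity hf hf_density]; simp)] with x hx using hx.ne

lemma measurable_bayesUpdate_apply (hf : Measurable (Function.uncurry f))
    (H : ProbabilityMeasure Θ) {A : Set Θ} (hA : MeasurableSet A) :
    Measurable fun x => (bayesUpdate f H x : Measure Θ) A :=
  (Measure.measurable_coe hA).comp ((measurable_bayesUpdate hf (H := fun _ : Unit => H)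
    measurable_const).comp (measurable_const.prodMk measurable_id : Measurable fun x => ((), x)))

lemma measurable_bayesUpdate_real (hf : Measurable (Function.uncurry f))
    (H : ProbabilityMeasure Θ) {A : Set Θ} (hA : MeasurableSet A) :
    Measurable fun x => (bayesUpdate f H x : Measure Θ).real A :=
  (measurable_bayesUpdate_apply hf H hA).ennreal_toReal

/-- The density of `F_H` cancels the normalisation of the posterior. This identity is the martingale
property of Newton's rule. -/
lemma integral_bayesUpdate_mixLaw (hf : Measurable (Function.uncurry f))
    (hf_density : ∀ θ, ∫⁻ x, (f x θ : ℝ≥0∞) ∂μ = 1) (H : ProbabilityMeasure Θ) {A : Set Θ}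
    (hA : MeasurableSet A) :
    ∫ x, (bayesUpdate f H x : Measure Θ).real A ∂(mixLaw μ f H) = (H : Measure Θ).real A := by
  have hm := measurable_bayesUpdate_apply hf H hA
  simp only [measureReal_def]
  rw [integral_toReal hm.aemeasurable (ae_of_all _ fun x => measure_lt_top _ _), mixLaw,
    lintegral_withDensity_eq_lintegral_mul _ (measurable_mixDensity hf H) hm,
    ← lintegral_posteriorMass hf hf_density H A]
  congr 1
  refine lintegral_congr_ae ?_
  filter_upwards [ae_mixDensity_ne_top hf hf_density H] with x hx
  rw [Pi.mul_apply, mul_comm, bayesUpdate_apply_mul f H hA hx]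

lemma integrable_of_measurable_of_abs_le {α : Type*} [MeasurableSpace α] {ν : Measure α}
    [IsFiniteMeasure ν] {g : α → ℝ} (hg : Measurable g) {C : ℝ} (h : ∀ x, |g x| ≤ C) :
    Integrable g ν :=
  Integrable.of_bound hg.aestronglyMeasurable C (ae_of_all _ h)

/-- The mean of the posterior mass under `F_H` is `H(A)`, so the plug-in variance is a genuine
variance: it is nonnegative and governs the conditional second moment of one step. -/
lemma integral_sq_bayesUpdate_sub (hf : Measurable (Function.uncurry f))
    (hf_density : ∀ θ, ∫⁻ x, (f x θ : ℝ≥0∞) ∂μ = 1) (H : ProbabilityMeasure Θ) {A : Set Θ}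
    (hA : MeasurableSet A) :
    ∫ x, ((bayesUpdate f H x : Measure Θ).real A - (H : Measure Θ).real A) ^ 2 ∂(mixLaw μ f H)
      = plugInVariance μ f A H := by
  have := isProbabilityMeasure_mixLaw hf hf_density H
  have hm := measurable_bayesUpdate_real hf H hA
  have h1 : Integrable (fun x => (bayesUpdate f H x : Measure Θ).real A) (mixLaw μ f H) :=
    integrable_of_measurable_of_abs_le hm (C := 1) fun x => by
      rw [abs_of_nonneg measureReal_nonneg]; exact measureReal_le_one
  have h2 : Integrable (fun x => (bayesUpdate f H x : Measure Θ).real A ^ 2) (mixLaw μ f H) :=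
    integrable_of_measurable_of_abs_le (hm.pow_const 2) (C := 1) fun x => by
      rw [abs_of_nonneg (by positivity)]
      exact pow_le_one₀ measureReal_nonneg measureReal_le_one
  have h3 := integral_bayesUpdate_mixLaw hf hf_density H hA
  set c := (H : Measure Θ).real A
  have : ∀ x, ((bayesUpdate f H x : Measure Θ).real A - c) ^ 2
      = (bayesUpdate f H x : Measure Θ).real A ^ 2
        - (2 * c) * (bayesUpdate f H x : Measure Θ).real A + c ^ 2 := fun x => by ring
  simp only [this]
  have h4 : Integrable (fun x => (bayesUpdate f H x : Measure Θ).real A ^ 2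
      - (2 * c) * (bayesUpdate f H x : Measure Θ).real A) (mixLaw μ f H) := h2.sub (h1.const_mul _)
  rw [integral_add h4 (integrable_const _), integral_sub h2 (h1.const_mul _), integral_const_mul, h3, integral_const, probReal_univ,
    one_smul]
  change _ = ∫ x, (bayesUpdate f H x : Measure Θ).real A ^ 2 ∂(mixLaw μ f H) - c ^ 2
  ring

lemma measurable_mixLaw (hf : Measurable (Function.uncurry f))
    {H : S → ProbabilityMeasure Θ} (hH : Measurable fun s => (H s : Measure Θ)) :
    Measurable fun s => mixLaw μ f (H s) := by
  refine Measure.measurable_of_measurable_coe _ fun B hB => ?_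
  simp only [mixLaw, withDensity_apply _ hB]
  exact (measurable_mixDensity_prod hf hH).lintegral_prod_right'

lemma mixLaw_apply (hf : Measurable (Function.uncurry f)) (H : ProbabilityMeasure Θ) {B : Set 𝕏}
    (hB : MeasurableSet B) :
    mixLaw μ f H B = ∫⁻ θ, ∫⁻ x in B, (f x θ : ℝ≥0∞) ∂μ ∂(H : Measure Θ) := by
  rw [mixLaw, withDensity_apply _ hB]
  simp only [mixDensity]
  rw [lintegral_lintegral_swap]
  exact hf.coe_nnreal_ennreal.aemeasurable

end Update

/-! ### Predictive law of the observations and the martingale `G_n(A)`. -/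

section Model

variable {𝕏 Θ Ω : Type*} [MeasurableSpace 𝕏] [MeasurableSpace Θ] [MeasurableSpace Ω]

lemma measurable_upTo {Z : ℕ → Ω → 𝕏} (hZ : ∀ n, 1 ≤ n → Measurable (Z n)) (n : ℕ) :
    Measurable (upTo Z n) :=
  measurable_pi_iff.2 fun _ => hZ _ (Nat.le_add_left _ _)

/-- The filtration generated by the observations. -/
def obsFiltration (X : ℕ → Ω → 𝕏) (hX : ∀ n, 1 ≤ n → Measurable (X n)) :
    Filtration ℕ (inferInstance : MeasurableSpace Ω) where
  seq n := MeasurableSpace.comap (upTo X n) inferInstance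
  mono' := monotone_nat_of_le_succ fun n => by
    have h : upTo X n = Fin.init ∘ upTo X (n + 1) := rfl
    rw [h, ← MeasurableSpace.comap_comp]
    exact MeasurableSpace.comap_mono measurable_init.comap_le
  le' n := (measurable_upTo hX n).comap_le

variable [StandardBorelSpace 𝕏] [Nonempty 𝕏] [StandardBorelSpace Θ] [Nonempty Θ]
  {P : Measure Ω} [IsProbabilityMeasure P] {μ : Measure 𝕏} [SigmaFinite μ] {f : 𝕏 → Θ → ℝ≥0}
  {G0 : ProbabilityMeasure Θ} {α : ℕ → Set.Ioo (0 : ℝ) 1} {X : ℕ → Ω → 𝕏} {θ : ℕ → Ω → Θ}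

/-- The predictive kernel: `F_{G_n}` as a function of the first `n` observations. -/
def predictiveKernel (μ : Measure 𝕏) [SigmaFinite μ] {f : 𝕏 → Θ → ℝ≥0}
    (hf : Measurable (Function.uncurry f)) (G0 : ProbabilityMeasure Θ)
    (α : ℕ → Set.Ioo (0 : ℝ) 1) (n : ℕ) : Kernel (Fin n → 𝕏) 𝕏 :=
  ⟨fun v => mixLaw μ f (finiteRule f G0 α n v), measurable_mixLaw hf (measurable_finiteRule hf G0 α n)⟩

lemma predictiveKernel_apply (hf : Measurable (Function.uncurry f)) (n : ℕ) (v : Fin n → 𝕏) :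
    predictiveKernel μ hf G0 α n v = mixLaw μ f (finiteRule f G0 α n v) := rfl

/-- The one-step predictive distribution of the observations is `F_{G_n}`. -/
theorem IsNewtonModel.map_upTo_prod (hmodel : IsNewtonModel μ f G0 α P X θ)
    (hf : Measurable (Function.uncurry f)) (hf_density : ∀ θ, ∫⁻ x, (f x θ : ℝ≥0∞) ∂μ = 1)
    (n : ℕ) :
    P.map (fun ω => (upTo X n ω, X (n + 1) ω))
      = P.map (upTo X n) ⊗ₘ predictiveKernel μ hf G0 α n := by
  have : IsMarkovKernel (predictiveKernel μ hf G0 α n) :=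
    ⟨fun v => isProbabilityMeasure_mixLaw hf hf_density _⟩
  have hX := measurable_upTo hmodel.measurable_obs n
  have hθ := measurable_upTo hmodel.measurable_param (n + 1)
  have hX1 := hmodel.measurable_obs (n + 1) (Nat.le_add_left _ _)
  have hθ1 := hmodel.measurable_param (n + 1) (Nat.le_add_left _ _)
  set W : Ω → (Fin n → 𝕏) × (Fin (n + 1) → Θ) := fun ω => (upTo X n ω, upTo θ (n + 1) ω)
  have hW : Measurable W := hX.prodMk hθ
  ext s hs
  -- The conditional mass of the section of `s` at `v` when the parameter is `t`.
  set g : (Fin n → 𝕏) → Θ → ℝ≥0∞ := fun v t => ∫⁻ x in Prod.mk v ⁻¹' s, (f x t : ℝ≥0∞) ∂μ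
    with hg
  have hgm : Measurable (Function.uncurry g) := by
    have h1 : Function.uncurry g = fun p : (Fin n → 𝕏) × Θ =>
        ∫⁻ x, {q : ((Fin n → 𝕏) × Θ) × 𝕏 | (q.1.1, q.2) ∈ s}.indicator
          (fun q => (f q.2 q.1.2 : ℝ≥0∞)) (p, x) ∂μ := by
      ext p
      change ∫⁻ x in Prod.mk p.1 ⁻¹' s, (f x p.2 : ℝ≥0∞) ∂μ = _
      rw [← lintegral_indicator (measurable_prodMk_left hs)]
      rfl
    rw [h1]
    refine Measurable.lintegral_prod_right' (Measurable.indicator ?_ ?_)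
    · exact (hf.comp (measurable_snd.prodMk
        (measurable_snd.comp measurable_fst))).coe_nnreal_ennreal
    · exact ((measurable_fst.comp measurable_fst).prodMk measurable_snd) hs
  -- Integrate out `X_{n+1}` given the past and the parameters up to `θ_{n+1}`; the past parameters
  -- disappear because the conditional density involves only `θ_{n+1}`.
  have h1 : P.map (fun ω => (upTo X n ω, X (n + 1) ω)) s
      = ∫⁻ ω, g (upTo X n ω) (θ (n + 1) ω) ∂P := by
    have e1 : P.map (fun ω => (upTo X n ω, X (n + 1) ω))
        = (P.map (fun ω => (W ω, X (n + 1) ω))).map (fun q => (q.1.1, q.2)) := by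
      rw [Measure.map_map (by fun_prop) (hW.prodMk hX1)]
      rfl
    have hs' : MeasurableSet ((fun q : ((Fin n → 𝕏) × (Fin (n + 1) → Θ)) × 𝕏 => (q.1.1, q.2)) ⁻¹' s) :=
      (by fun_prop : Measurable (fun q : ((Fin n → 𝕏) × (Fin (n + 1) → Θ)) × 𝕏 =>
        (q.1.1, q.2))) hs
    rw [e1, Measure.map_apply (by fun_prop) hs, ← compProd_map_condDistrib hX1.aemeasurable,
      Measure.compProd_apply hs', lintegral_map (Kernel.measurable_kernel_prodMk_left hs') hW]
    refine lintegral_congr_ae ?_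
    filter_upwards [hmodel.cond_obs n] with ω hω
    rw [hω, withDensity_apply _ (measurable_prodMk_left hs')]
    rfl
  -- Then integrate out `θ_{n+1}`, whose law given `X_{1:n}` is `G_n`.
  have h2 : ∫⁻ ω, g (upTo X n ω) (θ (n + 1) ω) ∂P
      = ∫⁻ ω, ∫⁻ t, g (upTo X n ω) t ∂(finiteRule f G0 α n (upTo X n ω) : Measure Θ) ∂P := by
    have e1 : ∫⁻ ω, g (upTo X n ω) (θ (n + 1) ω) ∂P
        = ∫⁻ q, Function.uncurry g q ∂(P.map fun ω => (upTo X n ω, θ (n + 1) ω)) := by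
      rw [lintegral_map hgm (hX.prodMk hθ1)]
      rfl
    rw [e1, ← compProd_map_condDistrib hθ1.aemeasurable, Measure.lintegral_compProd hgm,
      lintegral_map hgm.lintegral_kernel_prod_right' hX]
    refine lintegral_congr_ae ?_
    filter_upwards [hmodel.cond_param n] with ω hω
    rw [hω, finiteRule_upTo]
    rfl
  rw [h1, h2, Measure.compProd_apply hs, lintegral_map (Kernel.measurable_kernel_prodMk_left hs) hX]
  refine lintegral_congr fun ω => ?_
  rw [predictiveKernel_apply, mixLaw_apply hf _ (measurable_prodMk_left hs)]

/-- Conditional expectations of functions of `(X_{1:n}, X_{n+1})` given `X_{1:n}`. -/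
theorem IsNewtonModel.condExp_upTo (hmodel : IsNewtonModel μ f G0 α P X θ)
    (hf : Measurable (Function.uncurry f)) (hf_density : ∀ θ, ∫⁻ x, (f x θ : ℝ≥0∞) ∂μ = 1)
    (n : ℕ) {Ψ : (Fin n → 𝕏) × 𝕏 → ℝ} (hΨ : Measurable Ψ)
    (hint : Integrable (fun ω => Ψ (upTo X n ω, X (n + 1) ω)) P) :
    P[fun ω => Ψ (upTo X n ω, X (n + 1) ω) | obsFiltration X hmodel.measurable_obs n]
      =ᵐ[P] fun ω => ∫ x, Ψ (upTo X n ω, x) ∂(mixLaw μ f (finiteRule f G0 α n (upTo X n ω))) := by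
  have : IsMarkovKernel (predictiveKernel μ hf G0 α n) :=
    ⟨fun v => isProbabilityMeasure_mixLaw hf hf_density _⟩
  have hX := measurable_upTo hmodel.measurable_obs n
  have hX1 := hmodel.measurable_obs (n + 1) (Nat.le_add_left _ _)
  have h1 := condDistrib_ae_eq_of_measure_eq_compProd_of_measurable hX hX1
    (hmodel.map_upTo_prod hf hf_density n)
  have h2 := condExp_prod_ae_eq_integral_condDistrib hX hX1.aemeasurable
    hΨ.stronglyMeasurable hint
  filter_upwards [h2, ae_of_ae_map hX.aemeasurable h1] with ω h2 h1
  refine Eq.trans h2 ?_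
  rw [h1, predictiveKernel_apply]

/-- The mass `G_n(A)` as a random variable. -/
def ruleMass (f : 𝕏 → Θ → ℝ≥0) (G0 : ProbabilityMeasure Θ) (α : ℕ → Set.Ioo (0 : ℝ) 1)
    (X : ℕ → Ω → 𝕏) (A : Set Θ) (n : ℕ) (ω : Ω) : ℝ :=
  (finiteRule f G0 α n (upTo X n ω) : Measure Θ).real A

lemma ruleMass_mem_Icc (A : Set Θ) (n : ℕ) (ω : Ω) :
    ruleMass f G0 α X A n ω ∈ Set.Icc (0 : ℝ) 1 :=
  ⟨measureReal_nonneg, measureReal_le_one⟩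

lemma measurable_finiteRule_real (hf : Measurable (Function.uncurry f)) {A : Set Θ}
    (hA : MeasurableSet A) (n : ℕ) :
    Measurable fun v : Fin n → 𝕏 => (finiteRule f G0 α n v : Measure Θ).real A :=
  ((Measure.measurable_coe hA).comp (measurable_finiteRule hf G0 α n)).ennreal_toReal

lemma measurable_ruleMass (hX : ∀ n, 1 ≤ n → Measurable (X n))
    (hf : Measurable (Function.uncurry f)) {A : Set Θ} (hA : MeasurableSet A) (n : ℕ) :
    Measurable[obsFiltration X hX n] (ruleMass f G0 α X A n) :=
  (measurable_finiteRule_real hf hA n).comp (comap_measurable _)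

lemma ruleMass_succ_sub (A : Set Θ) (n : ℕ) (ω : Ω) :
    ruleMass f G0 α X A (n + 1) ω - ruleMass f G0 α X A n ω
      = α (n + 1) * ((bayesUpdate f (finiteRule f G0 α n (upTo X n ω)) (X (n + 1) ω) :
          Measure Θ).real A - (finiteRule f G0 α n (upTo X n ω) : Measure Θ).real A) := by
  have h : ruleMass f G0 α X A (n + 1) ω = (mix (α (n + 1)) (finiteRule f G0 α n (upTo X n ω))
      (bayesUpdate f (finiteRule f G0 α n (upTo X n ω)) (X (n + 1) ω)) : Measure Θ).real A := rfl
  rw [h, mix_real_apply, ruleMass]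
  ring

lemma measurable_increment (hf : Measurable (Function.uncurry f)) {A : Set Θ}
    (hA : MeasurableSet A) (n : ℕ) :
    Measurable fun p : (Fin n → 𝕏) × 𝕏 => (α (n + 1) : ℝ) *
      ((bayesUpdate f (finiteRule f G0 α n p.1) p.2 : Measure Θ).real A
        - (finiteRule f G0 α n p.1 : Measure Θ).real A) :=
  ((((Measure.measurable_coe hA).comp
    (measurable_bayesUpdate hf (measurable_finiteRule hf G0 α n))).ennreal_toReal).sub
      ((measurable_finiteRule_real hf hA n).comp measurable_fst)).const_mul _

lemma abs_ruleMass_succ_sub_le (A : Set Θ) (n : ℕ) (ω : Ω) :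
    |ruleMass f G0 α X A (n + 1) ω - ruleMass f G0 α X A n ω| ≤ α (n + 1) := by
  rw [ruleMass_succ_sub, abs_mul, abs_of_pos (α (n + 1)).2.1]
  refine mul_le_of_le_one_right (α (n + 1)).2.1.le ?_
  rw [abs_le]
  have h1 : (bayesUpdate f (finiteRule f G0 α n (upTo X n ω)) (X (n + 1) ω) :
    Measure Θ).real A ∈ Set.Icc (0 : ℝ) 1 := ⟨measureReal_nonneg, measureReal_le_one⟩
  have h2 : (finiteRule f G0 α n (upTo X n ω) : Measure Θ).real A ∈ Set.Icc (0 : ℝ) 1 :=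
    ⟨measureReal_nonneg, measureReal_le_one⟩
  constructor <;> linarith [h1.1, h1.2, h2.1, h2.2]

lemma condExp_ruleMass_succ_sub (hmodel : IsNewtonModel μ f G0 α P X θ)
    (hf : Measurable (Function.uncurry f)) (hf_density : ∀ θ, ∫⁻ x, (f x θ : ℝ≥0∞) ∂μ = 1)
    {A : Set Θ} (hA : MeasurableSet A) (n : ℕ) :
    P[fun ω => ruleMass f G0 α X A (n + 1) ω - ruleMass f G0 α X A n ω |
      obsFiltration X hmodel.measurable_obs n] =ᵐ[P] 0 := by
  have hm := (measurable_increment (G0 := G0) (α := α) hf hA n)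
  have hint : Integrable (fun ω => ruleMass f G0 α X A (n + 1) ω - ruleMass f G0 α X A n ω) P := by
    refine integrable_of_measurable_of_abs_le ?_ (abs_ruleMass_succ_sub_le A n)
    exact ((measurable_ruleMass hmodel.measurable_obs hf hA (n + 1)).mono
      ((obsFiltration X hmodel.measurable_obs).le _) le_rfl).sub
      ((measurable_ruleMass hmodel.measurable_obs hf hA n).mono
      ((obsFiltration X hmodel.measurable_obs).le _) le_rfl)
  simp only [ruleMass_succ_sub] at hint ⊢
  refine (hmodel.condExp_upTo hf hf_density n hm hint).trans (ae_of_all _ fun ω => ?_)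
  have := isProbabilityMeasure_mixLaw hf hf_density (finiteRule f G0 α n (upTo X n ω))
  simp only
  rw [integral_const_mul, integral_sub _ (integrable_const _),
    integral_bayesUpdate_mixLaw hf hf_density _ hA, integral_const, probReal_univ, one_smul,
    sub_self, mul_zero]
  · rfl
  · refine integrable_of_measurable_of_abs_le (measurable_bayesUpdate_real hf _ hA) (C := 1)
      fun x => ?_
    rw [abs_of_nonneg measureReal_nonneg]
    exact measureReal_le_one

lemma condExp_sq_ruleMass_succ_sub (hmodel : IsNewtonModel μ f G0 α P X θ)
    (hf : Measurable (Function.uncurry f)) (hf_density : ∀ θ, ∫⁻ x, (f x θ : ℝ≥0∞) ∂μ = 1)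
    {A : Set Θ} (hA : MeasurableSet A) (n : ℕ) :
    P[fun ω => (ruleMass f G0 α X A (n + 1) ω - ruleMass f G0 α X A n ω) ^ 2 |
      obsFiltration X hmodel.measurable_obs n] =ᵐ[P]
      fun ω => (α (n + 1) : ℝ) ^ 2 * plugInVariance μ f A (finiteRule f G0 α n (upTo X n ω)) := by
  have hm := (measurable_increment (G0 := G0) (α := α) hf hA n)
  have hint : Integrable
      (fun ω => (ruleMass f G0 α X A (n + 1) ω - ruleMass f G0 α X A n ω) ^ 2) P := by
    refine integrable_of_measurable_of_abs_le (C := (α (n + 1) : ℝ) ^ 2) ?_ fun ω => ?_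
    · exact (((measurable_ruleMass hmodel.measurable_obs hf hA (n + 1)).mono
        ((obsFiltration X hmodel.measurable_obs).le _) le_rfl).sub
        ((measurable_ruleMass hmodel.measurable_obs hf hA n).mono
        ((obsFiltration X hmodel.measurable_obs).le _) le_rfl)).pow_const 2
    · rw [abs_pow]
      exact pow_le_pow_left₀ (abs_nonneg _) (abs_ruleMass_succ_sub_le A n ω) 2
  simp only [ruleMass_succ_sub] at hint ⊢
  refine (hmodel.condExp_upTo hf hf_density n (hm.pow_const 2) hint).trans
    (ae_of_all _ fun ω => ?_)
  simp only [mul_pow]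
  rw [integral_const_mul, integral_sq_bayesUpdate_sub hf hf_density _ hA]

lemma martingale_ruleMass (hmodel : IsNewtonModel μ f G0 α P X θ)
    (hf : Measurable (Function.uncurry f)) (hf_density : ∀ θ, ∫⁻ x, (f x θ : ℝ≥0∞) ∂μ = 1)
    {A : Set Θ} (hA : MeasurableSet A) :
    Martingale (ruleMass f G0 α X A) (obsFiltration X hmodel.measurable_obs) P := by
  set ℱ := obsFiltration X hmodel.measurable_obs with hℱ
  have hmeas : ∀ n, Measurable[ℱ n] (ruleMass f G0 α X A n) := fun n =>
    measurable_ruleMass hmodel.measurable_obs hf hA n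
  have hint : ∀ n, Integrable (ruleMass f G0 α X A n) P := fun n => by
    refine integrable_of_measurable_of_abs_le ((hmeas n).mono (ℱ.le n) le_rfl) (C := 1) fun ω => ?_
    rw [abs_of_nonneg (ruleMass_mem_Icc A n ω).1]
    exact (ruleMass_mem_Icc A n ω).2
  refine martingale_of_condExp_sub_eq_zero_nat (fun n => (hmeas n).stronglyMeasurable) hint
    fun n => ?_
  exact condExp_ruleMass_succ_sub hmodel hf hf_density hA n

end Model

/-! ### Continuity of the plug-in variance. -/

section Variance

/-- For positive denominators, `b²/s` is the supremum over `q` of the affine forms `2qb - q²s`,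
attained at `q = b/s ∈ [0,1]`. Testing `c²/t` with the same `q` gives a Lipschitz bound that needs
no positive lower bound on `s` or `t`. -/
lemma sq_div_le_sq_div_add {b c s t : ℝ} (hb : 0 ≤ b) (hbs : b ≤ s) (hc : 0 ≤ c) (hct : c ≤ t) :
    b ^ 2 / s ≤ c ^ 2 / t + (2 * |b - c| + |s - t|) := by
  have hs : 0 ≤ s := hb.trans hbs
  have ht : 0 ≤ t := hc.trans hct
  set q := b / s with hq
  have hq0 : 0 ≤ q := div_nonneg hb hs
  have hq1 : q ≤ 1 := div_le_one_of_le₀ hbs hs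
  -- When `s = 0` the constraint `b ≤ s` forces `b = 0`, in agreement with `0 / 0 = 0`.
  have h1 : b ^ 2 / s = 2 * q * b - q ^ 2 * s := by
    rcases hs.eq_or_lt with h | h
    · have : b = 0 := le_antisymm (h ▸ hbs) hb
      simp [hq, ← h, this]
    · rw [hq]; field_simp; ring
  have h2 : 2 * q * c - q ^ 2 * t ≤ c ^ 2 / t := by
    rcases ht.eq_or_lt with h | h
    · have : c = 0 := le_antisymm (h ▸ hct) hc
      simp [← h, this]
    · rw [le_div_iff₀ h]
      nlinarith [sq_nonneg (c - q * t)]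
  have h3 : q * (b - c) ≤ |b - c| := by
    calc q * (b - c) ≤ q * |b - c| := by gcongr; exact le_abs_self _
      _ ≤ 1 * |b - c| := by gcongr
      _ = _ := one_mul _
  have h4 : q ^ 2 * (t - s) ≤ |s - t| := by
    calc q ^ 2 * (t - s) ≤ q ^ 2 * |s - t| := by
          gcongr; rw [abs_sub_comm]; exact le_abs_self _
      _ ≤ 1 * |s - t| := by gcongr; exact pow_le_one₀ hq0 hq1
      _ = _ := one_mul _
  linarith

lemma abs_sq_div_sub_sq_div_le {b c s t : ℝ} (hb : 0 ≤ b) (hbs : b ≤ s) (hc : 0 ≤ c)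
    (hct : c ≤ t) : |b ^ 2 / s - c ^ 2 / t| ≤ 2 * |b - c| + |s - t| := by
  rw [abs_sub_le_iff]
  have h1 := sq_div_le_sq_div_add hb hbs hc hct
  have h2 := sq_div_le_sq_div_add hc hct hb hbs
  rw [abs_sub_comm c b, abs_sub_comm t s] at h2
  constructor <;> linarith

/-- A one-sided form of Scheffé's lemma. -/
lemma tendsto_integral_abs_sub_of_le_liminf {S : Type*} [MeasurableSpace S] {μ : Measure S}
    {b : ℕ → S → ℝ≥0∞} {c : S → ℝ≥0∞} (hb : ∀ n, Measurable (b n)) (hc : Measurable c)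
    (hbtop : ∀ n, ∫⁻ x, b n x ∂μ ≠ ∞) (hctop : ∫⁻ x, c x ∂μ ≠ ∞)
    (hle : ∀ᵐ x ∂μ, c x ≤ liminf (fun n => b n x) atTop)
    (hlim : Tendsto (fun n => ∫⁻ x, b n x ∂μ) atTop (𝓝 (∫⁻ x, c x ∂μ))) :
    Tendsto (fun n => ∫ x, |(b n x).toReal - (c x).toReal| ∂μ) atTop (𝓝 0) := by
  have hbf : ∀ᵐ x ∂μ, ∀ n, b n x < ∞ := ae_all_iff.2 fun n => ae_lt_top (hb n) (hbtop n)
  have hcf : ∀ᵐ x ∂μ, c x < ∞ := ae_lt_top hc hctop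
  have hbi : ∀ n, Integrable (fun x => (b n x).toReal) μ := fun n =>
    integrable_toReal_of_lintegral_ne_top (hb n).aemeasurable (hbtop n)
  have hci : Integrable (fun x => (c x).toReal) μ :=
    integrable_toReal_of_lintegral_ne_top hc.aemeasurable hctop
  have h1 : Tendsto (fun n => ∫ x, ((c x).toReal - (b n x).toReal) ∂μ) atTop (𝓝 0) := by
    have h := (ENNReal.tendsto_toReal hctop).comp hlim
    have h' := (tendsto_const_nhds (x := (∫⁻ x, c x ∂μ).toReal)).sub h
    rw [sub_self] at h'
    refine h'.congr fun n => ?_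
    rw [integral_sub hci (hbi n), integral_toReal hc.aemeasurable hcf,
      integral_toReal (hb n).aemeasurable (hbf.mono fun x hx => hx n)]
    rfl
  -- The positive part of `c - b_n` is dominated by `c` and tends to zero as soon as `liminf b_n ≥
  -- c`; an upper bound on the limit of `b_n` is never needed.
  have h2 : Tendsto (fun n => ∫ x, max ((c x).toReal - (b n x).toReal) 0 ∂μ) atTop
      (𝓝 (∫ _, (0 : ℝ) ∂μ)) := by
    refine tendsto_integral_of_dominated_convergence (fun x => (c x).toReal)
      (fun n => ?_) hci (fun n => ae_of_all _ fun x => ?_) ?_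
    · exact ((hc.ennreal_toReal.sub (hb n).ennreal_toReal).max measurable_const).aestronglyMeasurable
    · rw [Real.norm_eq_abs, abs_of_nonneg (le_max_right _ _)]
      exact max_le (sub_le_self _ ENNReal.toReal_nonneg) ENNReal.toReal_nonneg
    · filter_upwards [hbf, hcf, hle] with x hbx hcx hx
      rw [Metric.tendsto_atTop]
      intro ε hε
      have hev : ∀ᶠ n in atTop, (c x).toReal - ε < (b n x).toReal := by
        by_cases h0 : c x = 0
        · refine Eventually.of_forall fun n => ?_
          rw [h0, ENNReal.toReal_zero]
          linarith [(ENNReal.toReal_nonneg : 0 ≤ (b n x).toReal)]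
        · have hlt : c x - ENNReal.ofReal ε < liminf (fun n => b n x) atTop :=
            (ENNReal.sub_lt_self hcx.ne h0 (by simpa using hε)).trans_le hx
          filter_upwards [eventually_lt_of_lt_liminf hlt] with n hn
          have h3 := (ENNReal.toReal_lt_toReal (ne_top_of_lt hn) (hbx n).ne).2 hn
          have h4 := ENNReal.le_toReal_sub (a := c x) (b := ENNReal.ofReal ε) ENNReal.ofReal_ne_top
          rw [ENNReal.toReal_ofReal hε.le] at h4
          linarith
      obtain ⟨N, hN⟩ := eventually_atTop.1 hev
      refine ⟨N, fun n hn => ?_⟩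
      rw [Real.dist_eq, sub_zero, abs_of_nonneg (le_max_right _ _)]
      exact max_lt (by linarith [hN n hn]) hε
  rw [integral_zero] at h2
  -- Because `|y| = 2 y⁺ - y` with `y = c - b_n`.
  have h3 := (h2.const_mul 2).sub h1
  rw [mul_zero, sub_zero] at h3
  refine h3.congr fun n => ?_
  rw [← integral_const_mul, ← integral_sub]
  · refine integral_congr_ae (ae_of_all _ fun x => ?_)
    simp only
    rcases le_total (c x).toReal (b n x).toReal with h | h
    · rw [max_eq_right (by linarith), abs_of_nonneg (by linarith)]; ring
    · rw [max_eq_left (by linarith), abs_of_nonpos (by linarith)]; ring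
  · exact ((hci.sub (hbi n)).pos_part).const_mul 2
  · exact hci.sub (hbi n)

variable {𝕏 Θ : Type*} [MeasurableSpace 𝕏] [MeasurableSpace Θ]
  {μ : Measure 𝕏} [SigmaFinite μ] {f : 𝕏 → Θ → ℝ≥0}

lemma measurable_posteriorMass_right (hf : Measurable (Function.uncurry f))
    (H : ProbabilityMeasure Θ) {A : Set Θ} (hA : MeasurableSet A) :
    Measurable (posteriorMass f H A) :=
  (measurable_posteriorMass hf (H := fun _ : Unit => H) measurable_const hA).comp
    (measurable_const.prodMk measurable_id : Measurable fun x => ((), x))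

/-- Moves the integral to the fixed measure `μ`, so that different `H` can be compared pointwise.
The zero set of `f_H` contributes nothing, by the convention `0 / 0 = 0`. -/
lemma integral_sq_bayesUpdate (hf : Measurable (Function.uncurry f))
    (hf_density : ∀ θ, ∫⁻ x, (f x θ : ℝ≥0∞) ∂μ = 1) (H : ProbabilityMeasure Θ) {A : Set Θ}
    (hA : MeasurableSet A) :
    ∫ x, (bayesUpdate f H x : Measure Θ).real A ^ 2 ∂(mixLaw μ f H)
      = ∫ x, (posteriorMass f H A x).toReal ^ 2 / (mixDensity f H x).toReal ∂μ := by
  have htop := ae_mixDensity_ne_top hf hf_density H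
  rw [mixLaw, integral_withDensity_eq_integral_toReal_smul (measurable_mixDensity hf H)
    (htop.mono fun x hx => hx.lt_top)]
  refine integral_congr_ae ?_
  filter_upwards [htop] with x hx
  rw [← bayesUpdate_apply_mul f H hA hx, ENNReal.toReal_mul, smul_eq_mul, measureReal_def]
  by_cases h0 : (mixDensity f H x).toReal = 0
  · simp [h0]
  · field_simp

lemma integrable_sq_div (hf : Measurable (Function.uncurry f))
    (hf_density : ∀ θ, ∫⁻ x, (f x θ : ℝ≥0∞) ∂μ = 1) (H : ProbabilityMeasure Θ) {A : Set Θ}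
    (hA : MeasurableSet A) :
    Integrable (fun x => (posteriorMass f H A x).toReal ^ 2 / (mixDensity f H x).toReal) μ := by
  have hi : Integrable (fun x => (mixDensity f H x).toReal) μ :=
    integrable_toReal_of_lintegral_ne_top (measurable_mixDensity hf H).aemeasurable
      (by rw [lintegral_mixDensity hf hf_density]; simp)
  refine hi.mono' (((measurable_posteriorMass_right hf H hA).ennreal_toReal.pow_const 2).div
    (measurable_mixDensity hf H).ennreal_toReal).aestronglyMeasurable ?_
  filter_upwards [ae_mixDensity_ne_top hf hf_density H] with x hx
  have h : (posteriorMass f H A x).toReal ≤ (mixDensity f H x).toReal :=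
    ENNReal.toReal_mono hx (posteriorMass_le_mixDensity f H A x)
  have h0 : 0 ≤ (posteriorMass f H A x).toReal := ENNReal.toReal_nonneg
  rw [Real.norm_eq_abs, abs_of_nonneg (by positivity)]
  refine div_le_of_le_mul₀ (h0.trans h) (h0.trans h) ?_
  nlinarith

/-- The plug-in variance is continuous along sequences whose masses converge and whose
unnormalised posterior masses satisfy Fatou's inequality. -/
theorem tendsto_plugInVariance (hf : Measurable (Function.uncurry f))
    (hf_density : ∀ θ, ∫⁻ x, (f x θ : ℝ≥0∞) ∂μ = 1) {H : ℕ → ProbabilityMeasure Θ}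
    {G : ProbabilityMeasure Θ} {A : Set Θ} (hA : MeasurableSet A)
    (hlim : Tendsto (fun n => (H n : Measure Θ) A) atTop (𝓝 ((G : Measure Θ) A)))
    (hleA : ∀ᵐ x ∂μ, posteriorMass f G A x ≤ liminf (fun n => posteriorMass f (H n) A x) atTop)
    (hle : ∀ᵐ x ∂μ, mixDensity f G x ≤ liminf (fun n => mixDensity f (H n) x) atTop) :
    Tendsto (fun n => plugInVariance μ f A (H n)) atTop (𝓝 (plugInVariance μ f A G)) := by
  have hB := tendsto_integral_abs_sub_of_le_liminf (μ := μ)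
    (fun n => measurable_posteriorMass_right hf (H n) hA) (measurable_posteriorMass_right hf G hA)
    (fun n => by rw [lintegral_posteriorMass hf hf_density]; exact measure_ne_top _ _)
    (by rw [lintegral_posteriorMass hf hf_density]; exact measure_ne_top _ _) hleA
    (by simpa only [lintegral_posteriorMass hf hf_density] using hlim)
  have hF := tendsto_integral_abs_sub_of_le_liminf (μ := μ)
    (fun n => measurable_mixDensity hf (H n)) (measurable_mixDensity hf G)
    (fun n => by rw [lintegral_mixDensity hf hf_density]; simp)
    (by rw [lintegral_mixDensity hf hf_density]; simp) hle
    (by simp only [lintegral_mixDensity hf hf_density]; exact tendsto_const_nhds)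
  have hBi : ∀ K : ProbabilityMeasure Θ, Integrable (fun x => (posteriorMass f K A x).toReal) μ :=
    fun K => integrable_toReal_of_lintegral_ne_top
      (measurable_posteriorMass_right hf K hA).aemeasurable
      (by rw [lintegral_posteriorMass hf hf_density]; exact measure_ne_top _ _)
  have hFi : ∀ K : ProbabilityMeasure Θ, Integrable (fun x => (mixDensity f K x).toReal) μ :=
    fun K => integrable_toReal_of_lintegral_ne_top (measurable_mixDensity hf K).aemeasurable
      (by rw [lintegral_mixDensity hf hf_density]; simp)
  have hmain : Tendsto (fun n => ∫ x, (bayesUpdate f (H n) x : Measure Θ).real A ^ 2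
      ∂(mixLaw μ f (H n))) atTop
      (𝓝 (∫ x, (bayesUpdate f G x : Measure Θ).real A ^ 2 ∂(mixLaw μ f G))) := by
    simp only [integral_sq_bayesUpdate hf hf_density _ hA]
    rw [tendsto_iff_dist_tendsto_zero]
    have h0 := (hB.const_mul 2).add hF
    rw [mul_zero, add_zero] at h0
    refine squeeze_zero (fun n => dist_nonneg) (fun n => ?_) h0
    have hi1 := ((hBi (H n)).sub (hBi G)).abs
    have hi2 := ((hFi (H n)).sub (hFi G)).abs
    simp only [Pi.sub_apply] at hi1 hi2
    rw [Real.dist_eq, ← integral_sub (integrable_sq_div hf hf_density _ hA)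
      (integrable_sq_div hf hf_density _ hA), ← integral_const_mul,
      ← integral_add (hi1.const_mul 2) hi2]
    refine (abs_integral_le_integral_abs).trans (integral_mono_ae ?_ ?_ ?_)
    · exact ((integrable_sq_div hf hf_density _ hA).sub
        (integrable_sq_div hf hf_density _ hA)).abs
    · exact (hi1.const_mul 2).add hi2
    · filter_upwards [ae_mixDensity_ne_top hf hf_density G,
        ae_mixDensity_ne_top hf hf_density (H n)] with x h1 h2
      exact abs_sq_div_sub_sq_div_le ENNReal.toReal_nonneg
        (ENNReal.toReal_mono h2 (posteriorMass_le_mixDensity f _ A x)) ENNReal.toReal_nonneg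
        (ENNReal.toReal_mono h1 (posteriorMass_le_mixDensity f _ A x))
  exact hmain.sub (((ENNReal.tendsto_toReal (measure_ne_top _ _)).comp hlim).pow 2)

/-- `F_H` gives no mass to the zero set of its own density. -/
lemma limitVariance_eq_plugInVariance (hf : Measurable (Function.uncurry f)) (A : Set Θ)
    (H : ProbabilityMeasure Θ) : limitVariance μ f A H = plugInVariance μ f A H := by
  have h0 : ∀ᵐ x ∂(mixLaw μ f H), x ∈ {x | mixDensity f H x ≠ 0} := by
    rw [mixLaw, ae_withDensity_iff (measurable_mixDensity hf H)]
    exact ae_of_all _ fun x hx => hx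
  rw [limitVariance, Measure.restrict_eq_self_of_ae_mem h0, plugInVariance]

lemma plugInVariance_mem_Icc (hf : Measurable (Function.uncurry f))
    (hf_density : ∀ θ, ∫⁻ x, (f x θ : ℝ≥0∞) ∂μ = 1) (H : ProbabilityMeasure Θ) {A : Set Θ}
    (hA : MeasurableSet A) : plugInVariance μ f A H ∈ Set.Icc (0 : ℝ) 1 := by
  have := isProbabilityMeasure_mixLaw hf hf_density H
  constructor
  · rw [← integral_sq_bayesUpdate_sub hf hf_density H hA]
    exact integral_nonneg fun x => sq_nonneg _
  · rw [plugInVariance]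
    have : ∫ x, (bayesUpdate f H x : Measure Θ).real A ^ 2 ∂(mixLaw μ f H) ≤ 1 := by
      refine (integral_mono_of_nonneg (ae_of_all _ fun x => sq_nonneg _) (integrable_const 1)
        (ae_of_all _ fun x => pow_le_one₀ measureReal_nonneg measureReal_le_one)).trans ?_
      simp
    linarith [sq_nonneg ((H : Measure Θ).real A)]

end Variance

/-! ### Almost sure convergence of `G_n` and of the plug-in variances. -/

section LimitMixing

/-- Fatou's lemma for a sequence of measures converging on each measurable set. -/
lemma ae_lintegral_le_liminf_lintegral {Ω Θ : Type*} [MeasurableSpace Ω] [MeasurableSpace Θ]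
    {P : Measure Ω} {K : ℕ → Ω → Measure Θ} {L : Ω → Measure Θ}
    (h : ∀ A, MeasurableSet A → ∀ᵐ ω ∂P, Tendsto (fun n => K n ω A) atTop (𝓝 (L ω A)))
    {g : Θ → ℝ≥0∞} (hg : Measurable g) :
    ∀ᵐ ω ∂P, ∫⁻ t, g t ∂(L ω) ≤ liminf (fun n => ∫⁻ t, g t ∂(K n ω)) atTop := by
  -- Each simple approximation has finitely many level sets, and there are countably many
  -- approximations, so the null sets can be united. The increasing supremum then gives lower
  -- semicontinuity.
  have h1 : ∀ᵐ ω ∂P, ∀ k, Tendsto (fun n => (SimpleFunc.eapprox g k).lintegral (K n ω)) atTop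
      (𝓝 ((SimpleFunc.eapprox g k).lintegral (L ω))) := by
    rw [ae_all_iff]
    intro k
    have h2 : ∀ᵐ ω ∂P, ∀ c ∈ (SimpleFunc.eapprox g k).range,
        Tendsto (fun n => K n ω (SimpleFunc.eapprox g k ⁻¹' {c})) atTop
          (𝓝 (L ω (SimpleFunc.eapprox g k ⁻¹' {c}))) :=
      (Finset.eventually_all _).2 fun c _ => h _ (SimpleFunc.measurableSet_fiber _ _)
    filter_upwards [h2] with ω hω
    refine tendsto_finsetSum _ fun c hc => ENNReal.Tendsto.const_mul (hω c hc) (Or.inr ?_)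
    obtain ⟨t, rfl⟩ := SimpleFunc.mem_range.1 hc
    exact (SimpleFunc.eapprox_lt_top g k t).ne
  filter_upwards [h1] with ω hω
  rw [lintegral_eq_iSup_eapprox_lintegral hg]
  refine iSup_le fun k => ?_
  rw [← (hω k).liminf_eq]
  refine liminf_le_liminf (Eventually.of_forall fun n => ?_)
  rw [lintegral_eq_iSup_eapprox_lintegral hg]
  exact le_iSup (fun k => (SimpleFunc.eapprox g k).lintegral (K n ω)) k

/-- Almost sure convergence of the masses of each measurable set implies almost sure weak
convergence. -/
lemma ae_tendsto_probabilityMeasure {Ω Θ : Type*} [MeasurableSpace Ω] [MeasurableSpace Θ]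
    [TopologicalSpace Θ] [SecondCountableTopology Θ] [OpensMeasurableSpace Θ]
    {P : Measure Ω} {K : ℕ → Ω → ProbabilityMeasure Θ} {L : Ω → ProbabilityMeasure Θ}
    (h : ∀ A, MeasurableSet A → ∀ᵐ ω ∂P,
      Tendsto (fun n => (K n ω : Measure Θ) A) atTop (𝓝 ((L ω : Measure Θ) A))) :
    ∀ᵐ ω ∂P, Tendsto (fun n => K n ω) atTop (𝓝 (L ω)) := by
  set B := TopologicalSpace.countableBasis Θ with hB
  have hbasis : TopologicalSpace.IsTopologicalBasis B := TopologicalSpace.isBasis_countableBasis Θ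
  have hBc : B.Countable := TopologicalSpace.countable_countableBasis Θ
  -- Finite intersections of a countable basis form a countable π-system containing a neighbourhood
  -- basis of each point; convergence on it, outside one null set, implies weak convergence.
  set S : Set (Set Θ) := (fun T => ⋂₀ T) '' {T | T.Finite ∧ T ⊆ B} with hS
  have hSc : S.Countable := (Set.countable_ofPred_finite_subset hBc).image _
  have hSm : ∀ s ∈ S, MeasurableSet s := by
    rintro _ ⟨T, ⟨hTf, hTB⟩, rfl⟩
    exact MeasurableSet.sInter hTf.countable fun t ht => (hbasis.isOpen (hTB ht)).measurableSet
  have hSpi : IsPiSystem S := by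
    rintro _ ⟨T, ⟨hTf, hTB⟩, rfl⟩ _ ⟨U, ⟨hUf, hUB⟩, rfl⟩ _
    exact ⟨T ∪ U, ⟨hTf.union hUf, Set.union_subset hTB hUB⟩, Set.sInter_union T U⟩
  have hae : ∀ᵐ ω ∂P, ∀ s ∈ S,
      Tendsto (fun n => (K n ω : Measure Θ) s) atTop (𝓝 ((L ω : Measure Θ) s)) :=
    (ae_ball_iff hSc).2 fun s hs => h s (hSm s hs)
  filter_upwards [hae] with ω hω
  refine hSpi.tendsto_probabilityMeasure_of_tendsto_of_mem hSm (fun u hu x hx => ?_) fun s hs => ?_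
  · obtain ⟨v, hv, hxv, hvu⟩ := hbasis.exists_subset_of_mem_open hx hu
    exact ⟨v, ⟨{v}, ⟨Set.finite_singleton v, by simpa using hv⟩, by simp⟩,
      (hbasis.isOpen hv).mem_nhds hxv, hvu⟩
  · exact (ENNReal.tendsto_toNNReal (measure_ne_top _ _)).comp (hω s hs)

variable {𝕏 Θ Ω : Type*} [MeasurableSpace 𝕏] [MeasurableSpace Θ] [MeasurableSpace Ω]
  [StandardBorelSpace 𝕏] [Nonempty 𝕏] [StandardBorelSpace Θ] [Nonempty Θ]
  {P : Measure Ω} [IsProbabilityMeasure P] {μ : Measure 𝕏} [SigmaFinite μ] {f : 𝕏 → Θ → ℝ≥0}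
  {G0 : ProbabilityMeasure Θ} {α : ℕ → Set.Ioo (0 : ℝ) 1} {X : ℕ → Ω → 𝕏} {θ : ℕ → Ω → Θ}

lemma ae_exists_tendsto_ruleMass (hmodel : IsNewtonModel μ f G0 α P X θ)
    (hf : Measurable (Function.uncurry f)) (hf_density : ∀ θ, ∫⁻ x, (f x θ : ℝ≥0∞) ∂μ = 1)
    {A : Set Θ} (hA : MeasurableSet A) :
    ∀ᵐ ω ∂P, ∃ c, Tendsto (fun n => ruleMass f G0 α X A n ω) atTop (𝓝 c) := by
  refine (martingale_ruleMass hmodel hf hf_density hA).submartingale.exists_ae_tendsto_of_bdd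
    (R := 1) fun n => ?_
  refine (eLpNorm_le_of_ae_bound (C := 1) (ae_of_all _ fun ω => ?_)).trans ?_
  · rw [Real.norm_eq_abs, abs_of_nonneg (ruleMass_mem_Icc A n ω).1]
    exact (ruleMass_mem_Icc A n ω).2
  · simp

/-- The random limit of Newton's rule, setwise. -/
theorem exists_random_limit (hmodel : IsNewtonModel μ f G0 α P X θ)
    (hf : Measurable (Function.uncurry f)) (hf_density : ∀ θ, ∫⁻ x, (f x θ : ℝ≥0∞) ∂μ = 1) :
    ∃ G : Ω → ProbabilityMeasure Θ, (Measurable fun ω => (G ω : Measure Θ)) ∧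
      ∀ A, MeasurableSet A → ∀ᵐ ω ∂P,
        Tendsto (fun n => (finiteRule f G0 α n (upTo X n ω) : Measure Θ) A) atTop
          (𝓝 ((G ω : Measure Θ) A)) := by
  let K : ℕ → Kernel Ω Θ := fun n => ⟨fun ω => (finiteRule f G0 α n (upTo X n ω) : Measure Θ),
    (measurable_finiteRule hf G0 α n).comp (measurable_upTo hmodel.measurable_obs n)⟩
  have hK : ∀ n, IsMarkovKernel (K n) := fun n => ⟨fun ω => (finiteRule f G0 α n (upTo X n ω)).2⟩
  have hKr : ∀ n ω A, K n ω A = ENNReal.ofReal (ruleMass f G0 α X A n ω) := fun n ω A =>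
    (ofReal_measureReal (μ := K n ω)).symm
  have h1 : ∀ A, MeasurableSet A → ∀ᵐ ω ∂P, ∃ c, Tendsto (fun n => K n ω A) atTop (𝓝 c) := by
    intro A hA
    filter_upwards [ae_exists_tendsto_ruleMass hmodel hf hf_density hA] with ω ⟨c, hc⟩
    refine ⟨ENNReal.ofReal c, ?_⟩
    simp only [hKr]
    exact (ENNReal.continuous_ofReal.tendsto c).comp hc
  -- The martingale has constant mean, equal to its value `G_0(A)` at time zero.
  have h2 : ∀ n A, MeasurableSet A → ∫⁻ ω, K n ω A ∂P = (G0 : Measure Θ) A := by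
    intro n A hA
    have hmart := martingale_ruleMass hmodel hf hf_density hA
    have h1 : ∫ ω, ruleMass f G0 α X A n ω ∂P = (G0 : Measure Θ).real A := by
      have h2 := hmart.setIntegral_eq (Nat.zero_le n) MeasurableSet.univ
      rw [setIntegral_univ, setIntegral_univ] at h2
      rw [← h2]
      have h3 : ∀ ω, ruleMass f G0 α X A 0 ω = (G0 : Measure Θ).real A := fun ω => rfl
      simp only [h3, integral_const, probReal_univ, one_smul]
    simp only [hKr]
    rw [← ofReal_integral_eq_lintegral_ofReal (hmart.integrable n)
      (ae_of_all _ fun ω => (ruleMass_mem_Icc A n ω).1), h1, ofReal_measureReal]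
  obtain ⟨L, hL, hLlim⟩ := exists_kernel_forall_ae_tendsto P K (G0 : Measure Θ) h1 h2
  exact ⟨fun ω => ⟨L ω, hL.isProbabilityMeasure ω⟩, L.measurable, hLlim⟩

/-- Almost sure convergence of the plug-in variances. -/
theorem ae_tendsto_plugInVariance (hmodel : IsNewtonModel μ f G0 α P X θ)
    (hf : Measurable (Function.uncurry f)) (hf_density : ∀ θ, ∫⁻ x, (f x θ : ℝ≥0∞) ∂μ = 1)
    {G : Ω → ProbabilityMeasure Θ} (hG : Measurable fun ω => (G ω : Measure Θ))
    (hlim : ∀ A, MeasurableSet A → ∀ᵐ ω ∂P,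
      Tendsto (fun n => (finiteRule f G0 α n (upTo X n ω) : Measure Θ) A) atTop
        (𝓝 ((G ω : Measure Θ) A))) {A : Set Θ} (hA : MeasurableSet A) :
    ∀ᵐ ω ∂P, Tendsto (fun n => plugInVariance μ f A (finiteRule f G0 α n (upTo X n ω))) atTop
      (𝓝 (plugInVariance μ f A (G ω))) := by
  have hmeas : ∀ n, Measurable fun ω => (finiteRule f G0 α n (upTo X n ω) : Measure Θ) := fun n =>
    (measurable_finiteRule hf G0 α n).comp (measurable_upTo hmodel.measurable_obs n)
  have hfatou : ∀ B, MeasurableSet B → ∀ᵐ ω ∂P, ∀ᵐ x ∂μ, posteriorMass f (G ω) B x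
      ≤ liminf (fun n => posteriorMass f (finiteRule f G0 α n (upTo X n ω)) B x) atTop := by
    intro B hB
    have hms : MeasurableSet {p : Ω × 𝕏 | posteriorMass f (G p.1) B p.2
        ≤ liminf (fun n => posteriorMass f (finiteRule f G0 α n (upTo X n p.1)) B p.2) atTop} :=
      measurableSet_le (measurable_posteriorMass hf hG hB)
        (Measurable.liminf fun n => measurable_posteriorMass hf (hmeas n) hB)
    -- Fatou's inequality is available for each fixed `x`, outside a null set of `ω` that depends on
    -- `x`; Fubini exchanges the two quantifiers.
    rw [Measure.ae_ae_comm hms]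
    refine ae_of_all _ fun x => ?_
    have hg : Measurable fun t => (f x t : ℝ≥0∞) :=
      (hf.comp (measurable_const.prodMk measurable_id)).coe_nnreal_ennreal
    have := ae_lintegral_le_liminf_lintegral hlim (hg.indicator hB)
    simp only [lintegral_indicator hB] at this
    exact this
  filter_upwards [hlim A hA, hfatou A hA, hfatou _ MeasurableSet.univ] with ω h1 h2 h3
  simp only [posteriorMass_univ] at h3
  exact tendsto_plugInVariance hf hf_density hA h1 h2 h3

/-- Newton's rule converges weakly almost surely, to a limit which is also a setwise limit. -/
theorem exists_ae_eq_limitMixing [TopologicalSpace Θ] [TopologicalSpace.MetrizableSpace Θ]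
    [SecondCountableTopology Θ] [BorelSpace Θ] (hmodel : IsNewtonModel μ f G0 α P X θ)
    (hf : Measurable (Function.uncurry f)) (hf_density : ∀ θ, ∫⁻ x, (f x θ : ℝ≥0∞) ∂μ = 1) :
    ∃ G : Ω → ProbabilityMeasure Θ, (Measurable fun ω => (G ω : Measure Θ)) ∧
      (∀ A, MeasurableSet A → ∀ᵐ ω ∂P,
        Tendsto (fun n => (finiteRule f G0 α n (upTo X n ω) : Measure Θ) A) atTop
          (𝓝 ((G ω : Measure Θ) A))) ∧
      (∀ᵐ ω ∂P, limitMixing f G0 α (path X ω) = G ω ∧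
        Tendsto (newtonRule f G0 α (path X ω)) atTop (𝓝 (G ω))) := by
  let _ := TopologicalSpace.metrizableSpaceMetric Θ
  obtain ⟨G, hG, hlim⟩ := exists_random_limit hmodel hf hf_density
  refine ⟨G, hG, hlim, ?_⟩
  filter_upwards [ae_tendsto_probabilityMeasure hlim] with ω hω
  simp only [finiteRule_upTo] at hω
  exact ⟨hω.limUnder_eq, hω⟩

end LimitMixing

/-! ### Quantitative estimate for conditional characteristic functions. -/

section ConditionalCLT

/-- Taylor expansion of `e^{ix}` to second order and of `e^{-c}` to first order. When `c` is close
to the conditional mean of `x²/2`, the subtracted polynomial is nearly centred and only higher-order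
terms remain. -/
lemma norm_exp_mul_I_sub_exp_neg_le {x c : ℝ} (hx : |x| ≤ 1) (hc : |c| ≤ 1) :
    ‖Complex.exp (x * Complex.I) - (Real.exp (-c) : ℂ) - (x * Complex.I - x ^ 2 / 2 + c)‖
      ≤ |x| ^ 3 / 4 + c ^ 2 := by
  have h1 : ‖Complex.exp (x * Complex.I) - (1 + x * Complex.I - x ^ 2 / 2)‖ ≤ |x| ^ 3 / 4 := by
    have hn : ‖(x * Complex.I : ℂ)‖ = |x| := by simp
    have h := Complex.exp_bound (x := x * Complex.I) (by rw [hn]; exact hx) (n := 3) (by norm_num)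
    rw [hn] at h
    have e1 : ∑ m ∈ Finset.range 3, (x * Complex.I : ℂ) ^ m / m.factorial
        = 1 + x * Complex.I - x ^ 2 / 2 := by
      simp [Finset.sum_range_succ, mul_pow]
      ring
    rw [e1] at h
    refine h.trans ?_
    have : (0 : ℝ) ≤ |x| ^ 3 := by positivity
    norm_num [Nat.factorial]
    linarith
  have h2 : ‖((Real.exp (-c) - 1 - (-c) : ℝ) : ℂ)‖ ≤ c ^ 2 := by
    rw [Complex.norm_real, Real.norm_eq_abs]
    simpa using Real.abs_exp_sub_one_sub_id_le (x := -c) (by simpa using hc)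
  have e2 : Complex.exp (x * Complex.I) - (Real.exp (-c) : ℂ) - (x * Complex.I - x ^ 2 / 2 + c)
      = (Complex.exp (x * Complex.I) - (1 + x * Complex.I - x ^ 2 / 2))
        - ((Real.exp (-c) - 1 - (-c) : ℝ) : ℂ) := by
    push_cast
    ring
  rw [e2]
  exact (norm_sub_le _ _).trans (add_le_add h1 h2)

variable {Ω : Type*} {mΩ : MeasurableSpace Ω} {P : Measure Ω} [IsProbabilityMeasure P]

/-- A bounded known factor comes out of the conditional expectation; the rule is applied to the
bilinear map `ℂ × ℝ → ℂ` given by scalar multiplication. -/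
lemma condExp_smul_eq_zero {m : MeasurableSpace Ω} {D : Ω → ℝ} {W : Ω → ℂ} {C : ℝ}
    (hm : m ≤ mΩ) (hD : Integrable D P) (hW : Measurable[m] W) (hWb : ∀ ω, ‖W ω‖ ≤ C)
    (h : P[D | m] =ᵐ[P] 0) : P[fun ω => D ω • W ω | m] =ᵐ[P] 0 := by
  have hWm : StronglyMeasurable[m] W := hW.stronglyMeasurable
  have hi : Integrable (fun ω => D ω • W ω) P :=
    hD.smul_bdd C (hWm.mono hm).aestronglyMeasurable (ae_of_all _ hWb)
  have h1 := condExp_bilin_of_stronglyMeasurable_left (μ := P)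
    (B := (ContinuousLinearMap.lsmul ℝ ℝ : ℝ →L[ℝ] ℂ →L[ℝ] ℂ).flip) hWm (g := D)
    (by simpa using hi) hD
  filter_upwards [h1, h] with ω h1 h
  simp only [ContinuousLinearMap.flip_apply, ContinuousLinearMap.lsmul_apply] at h1
  rw [h1, h]
  simp

/-- Quantitative conditional central limit estimate for a martingale with bounded increments. -/
theorem norm_condExp_exp_sub_one_le {ℱ : Filtration ℕ mΩ} {M V : ℕ → Ω → ℝ} {a : ℕ → ℝ}
    {Minf lam Y : Ω → ℝ} {q l b : ℝ}
    (hM : ∀ k, Measurable[ℱ k] (M k)) (hV : ∀ k, Measurable[ℱ k] (V k))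
    (hV0 : ∀ k ω, 0 ≤ V k ω) (hV1 : ∀ k ω, V k ω ≤ 1)
    (ha : ∀ k, 0 ≤ a k) (hab : ∀ k, a k ≤ b)
    (hinc : ∀ k ω, |M (k + 1) ω - M k ω| ≤ a k)
    (hE1 : ∀ k, P[fun ω => M (k + 1) ω - M k ω | ℱ k] =ᵐ[P] 0)
    (hE2 : ∀ k, P[fun ω => (M (k + 1) ω - M k ω) ^ 2 | ℱ k] =ᵐ[P] fun ω => a k ^ 2 * V k ω)
    (hlim : ∀ᵐ ω ∂P, Tendsto (fun k => M k ω) atTop (𝓝 (Minf ω)))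
    (hlam : Measurable[ℱ 0] lam) (hq : ∀ ω, lam ω ^ 2 * V 0 ω ≤ q) (hl : ∀ ω, |lam ω| ≤ l)
    (hs : Summable fun k => a k ^ 2) (hlb : l * b ≤ 1)
    (hY : Integrable Y P) (hVY : ∀ k ω, |V k ω - V 0 ω| ≤ Y ω) :
    ∀ᵐ ω ∂P, ‖P[fun ω => Complex.exp ((lam ω * (Minf ω - M 0 ω) : ℝ) * Complex.I)
        * (Real.exp (lam ω ^ 2 * V 0 ω / 2 * ∑' k, a k ^ 2) : ℂ) - 1 | ℱ 0] ω‖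
      ≤ P[fun ω => Real.exp (q / 2 * ∑' k, a k ^ 2) *
          (l ^ 2 * (∑' k, a k ^ 2) / 2 * Y ω + l ^ 3 * b * ∑' k, a k ^ 2) | ℱ 0] ω := by
  set s := ∑' k, a k ^ 2 with hsdef
  -- A point of `Ω` serves only to deduce `0 ≤ l` and `0 ≤ q` from the pointwise bounds.
  have hΩ : Nonempty Ω := by
    by_contra h
    rw [not_nonempty_iff] at h
    have := measure_univ (μ := P)
    simp [Set.univ_eq_empty_iff.2 h] at this
  obtain ⟨ω₀⟩ := hΩ
  have hl0 : 0 ≤ l := (abs_nonneg _).trans (hl ω₀)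
  have hq0 : 0 ≤ q := (mul_nonneg (sq_nonneg _) (hV0 0 ω₀)).trans (hq ω₀)
  have hla : ∀ k, l * a k ≤ 1 := fun k => (mul_le_mul_of_nonneg_left (hab k) hl0).trans hlb
  have hMm : ∀ k, Measurable (M k) := fun k => (hM k).mono (ℱ.le k) le_rfl
  have hVm : ∀ k, Measurable (V k) := fun k => (hV k).mono (ℱ.le k) le_rfl
  have hlamk : ∀ k, Measurable[ℱ k] lam := fun k => hlam.mono (ℱ.mono (Nat.zero_le k)) le_rfl
  have hV0k : ∀ k, Measurable[ℱ k] (V 0) := fun k => (hV 0).mono (ℱ.mono (Nat.zero_le k)) le_rfl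
  have hM0k : ∀ k, Measurable[ℱ k] (M 0) := fun k => (hM 0).mono (ℱ.mono (Nat.zero_le k)) le_rfl
  set S : ℕ → ℝ := fun k => ∑ j ∈ Finset.range k, a j ^ 2 with hS
  have hSs : ∀ k, S k ≤ s := fun k => hs.sum_le_tsum _ fun _ _ => sq_nonneg _
  have hS0 : ∀ k, 0 ≤ S k := fun k => Finset.sum_nonneg fun _ _ => sq_nonneg _
  have hs0 : 0 ≤ s := (hS0 0).trans (hSs 0)
  have hSsucc : ∀ k, S (k + 1) = S k + a k ^ 2 := fun k => Finset.sum_range_succ _ _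
  have hSlim : Tendsto S atTop (𝓝 s) := hs.hasSum.tendsto_sum_nat
  set Z : ℕ → Ω → ℂ := fun k ω => Complex.exp ((lam ω * (M k ω - M 0 ω) : ℝ) * Complex.I) with hZ
  -- The compensator uses the frozen variance `V 0`, not `V k`, so it is known at time zero and can
  -- be divided out afterwards. The price is `|V k - V 0| ≤ Y`.
  set E : ℝ → Ω → ℝ := fun t ω => Real.exp (lam ω ^ 2 * V 0 ω / 2 * t) with hE
  set U : ℕ → Ω → ℂ := fun k ω => Z k ω * (E (S k) ω : ℂ) with hU
  -- The common factor of `U (k + 1)` and `U k`: with `x` and `c` as in `hstep`, `U (k + 1) - U k =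
  -- W k * (e^{ix} - e^{-c})`.
  set W : ℕ → Ω → ℂ := fun k ω => Z k ω * (E (S (k + 1)) ω : ℂ) with hW
  set C := Real.exp (q / 2 * s) with hC
  have hEle : ∀ t ≤ s, ∀ ω, 0 ≤ t → E t ω ≤ C := fun t ht ω ht0 => by
    refine Real.exp_le_exp.2 (mul_le_mul (by linarith [hq ω]) ht ht0 (by linarith))
  have hZn : ∀ k ω, ‖Z k ω‖ = 1 := fun k ω => Complex.norm_exp_ofReal_mul_I _
  have hEn : ∀ t ω, ‖(E t ω : ℂ)‖ = E t ω := fun t ω => by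
    rw [Complex.norm_real, Real.norm_eq_abs, abs_of_pos (Real.exp_pos _)]
  have hUn : ∀ k ω, ‖U k ω‖ ≤ C := fun k ω => by
    rw [hU, norm_mul, hZn, one_mul, hEn]
    exact hEle _ (hSs k) ω (hS0 k)
  have hWn : ∀ k ω, ‖W k ω‖ ≤ C := fun k ω => by
    rw [hW, norm_mul, hZn, one_mul, hEn]
    exact hEle _ (hSs _) ω (hS0 _)
  have hZm : ∀ k, Measurable[ℱ k] (Z k) := fun k =>
    ((Complex.measurable_ofReal.comp ((hlamk k).mul ((hM k).sub (hM0k k)))).mul_const _).cexp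
  have hEm : ∀ t k, Measurable[ℱ k] (E t) := fun t k =>
    (((((hlamk k).pow_const 2).mul (hV0k k)).div_const 2).mul_const t).exp
  have hUm : ∀ k, Measurable[ℱ k] (U k) := fun k =>
    (hZm k).mul (Complex.measurable_ofReal.comp (hEm _ k))
  have hWm : ∀ k, Measurable[ℱ k] (W k) := fun k =>
    (hZm k).mul (Complex.measurable_ofReal.comp (hEm _ k))
  set D : ℕ → Ω → ℝ := fun k ω => M (k + 1) ω - M k ω with hD
  set D2 : ℕ → Ω → ℝ := fun k ω => D k ω ^ 2 - a k ^ 2 * V k ω with hD2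
  have hDi : ∀ k, Integrable (D k) P := fun k =>
    integrable_of_measurable_of_abs_le ((hMm _).sub (hMm _)) (hinc k)
  have hDsq : ∀ k, Integrable (fun ω => D k ω ^ 2) P := fun k =>
    integrable_of_measurable_of_abs_le (((hMm _).sub (hMm _)).pow_const 2) (C := a k ^ 2)
      fun ω => by rw [abs_pow]; exact pow_le_pow_left₀ (abs_nonneg _) (hinc k ω) 2
  have hVi : ∀ k, Integrable (fun ω => a k ^ 2 * V k ω) P := fun k =>
    (integrable_of_measurable_of_abs_le (hVm k) (C := 1)
      fun ω => by rw [abs_of_nonneg (hV0 k ω)]; exact hV1 k ω).const_mul _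
  have hD2i : ∀ k, Integrable (D2 k) P := fun k => (hDsq k).sub (hVi k)
  have hD2E : ∀ k, P[D2 k | ℱ k] =ᵐ[P] 0 := fun k => by
    have h1 : P[D2 k | ℱ k] =ᵐ[P] P[fun ω => D k ω ^ 2 | ℱ k] - P[fun ω => a k ^ 2 * V k ω | ℱ k] :=
      condExp_sub (hDsq k) (hVi k) _
    have h2 : P[fun ω => a k ^ 2 * V k ω | ℱ k] = fun ω => a k ^ 2 * V k ω :=
      condExp_of_stronglyMeasurable (ℱ.le k) ((hV k).const_mul _).stronglyMeasurable (hVi k)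
    rw [h2] at h1
    filter_upwards [h1, hE2 k] with ω h1 h3
    rw [h1, Pi.sub_apply, h3]
    simp
  set W1 : ℕ → Ω → ℂ := fun k ω => W k ω * (lam ω * Complex.I) with hW1
  set W2 : ℕ → Ω → ℂ := fun k ω => W k ω * (-(lam ω ^ 2 / 2) : ℝ) with hW2
  have hW1n : ∀ k ω, ‖W1 k ω‖ ≤ C * l := fun k ω => by
    have : ‖(lam ω * Complex.I : ℂ)‖ ≤ l := by simpa using hl ω
    rw [hW1, norm_mul]
    exact mul_le_mul (hWn k ω) this (norm_nonneg _) (Real.exp_pos _).le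
  have hlamsq : ∀ ω, lam ω ^ 2 ≤ l ^ 2 := fun ω => by
    rw [← sq_abs]; exact pow_le_pow_left₀ (abs_nonneg _) (hl ω) 2
  have hW2n : ∀ k ω, ‖W2 k ω‖ ≤ C * (l ^ 2 / 2) := fun k ω => by
    have : ‖((-(lam ω ^ 2 / 2) : ℝ) : ℂ)‖ ≤ l ^ 2 / 2 := by
      rw [Complex.norm_real, Real.norm_eq_abs, abs_neg, abs_of_nonneg (by positivity)]
      linarith [hlamsq ω]
    rw [hW2, norm_mul]
    exact mul_le_mul (hWn k ω) this (norm_nonneg _) (Real.exp_pos _).le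
  have hW1m : ∀ k, Measurable[ℱ k] (W1 k) := fun k =>
    (hWm k).mul ((Complex.measurable_ofReal.comp (hlamk k)).mul_const _)
  have hW2m : ∀ k, Measurable[ℱ k] (W2 k) := fun k =>
    (hWm k).mul (Complex.measurable_ofReal.comp (((hlamk k).pow_const 2).div_const 2).neg)
  -- The martingale-difference part of `U (k + 1) - U k`: the linear Taylor term, and the quadratic
  -- one centred by its conditional mean.
  set ξ : ℕ → Ω → ℂ := fun k ω => D k ω • W1 k ω + D2 k ω • W2 k ω with hξ
  have hi1 : ∀ k, Integrable (fun ω => D k ω • W1 k ω) P := fun k =>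
    (hDi k).smul_bdd _ ((hW1m k).mono (ℱ.le k) le_rfl).aestronglyMeasurable
      (ae_of_all _ (hW1n k))
  have hi2 : ∀ k, Integrable (fun ω => D2 k ω • W2 k ω) P := fun k =>
    (hD2i k).smul_bdd _ ((hW2m k).mono (ℱ.le k) le_rfl).aestronglyMeasurable
      (ae_of_all _ (hW2n k))
  have hξi : ∀ k, Integrable (ξ k) P := fun k => (hi1 k).add (hi2 k)
  have hξ0 : ∀ k, P[ξ k | ℱ 0] =ᵐ[P] 0 := fun k => by
    have h1 : P[ξ k | ℱ k] =ᵐ[P] 0 := by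
      have e := condExp_add (hi1 k) (hi2 k) (ℱ k)
      filter_upwards [e, condExp_smul_eq_zero (ℱ.le k) (hDi k) (hW1m k) (hW1n k) (hE1 k),
        condExp_smul_eq_zero (ℱ.le k) (hD2i k) (hW2m k) (hW2n k) (hD2E k)] with ω e e1 e2
      refine e.trans ?_
      rw [Pi.add_apply, e1, e2]
      simp
    have h2 : P[P[ξ k | ℱ k] | ℱ 0] =ᵐ[P] P[ξ k | ℱ 0] :=
      condExp_condExp_of_le (ℱ.mono (Nat.zero_le k)) (ℱ.le k)
    refine h2.symm.trans ((condExp_congr_ae h1).trans ?_)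
    rw [show (0 : Ω → ℂ) = fun _ => 0 from rfl, condExp_const (ℱ.le 0)]
  have hstep : ∀ k ω, ‖U (k + 1) ω - U k ω - ξ k ω‖
      ≤ C * (l ^ 2 / 2 * Y ω + l ^ 3 * b) * a k ^ 2 := by
    intro k ω
    set x := lam ω * D k ω with hx
    set c := lam ω ^ 2 * V 0 ω / 2 * a k ^ 2 with hc
    have hxl : |x| ≤ l * a k := by
      rw [hx, abs_mul]; exact mul_le_mul (hl ω) (hinc k ω) (abs_nonneg _) hl0
    have hx1 : |x| ≤ 1 := hxl.trans (hla k)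
    have hc0 : 0 ≤ c := by have := hV0 0 ω; positivity
    have hcl : c ≤ (l * a k) ^ 2 / 2 := by
      have h1 : lam ω ^ 2 * V 0 ω ≤ l ^ 2 * 1 :=
        mul_le_mul (hlamsq ω) (hV1 0 ω) (hV0 0 ω) (sq_nonneg _)
      have h2 : c ≤ (l ^ 2 * 1) / 2 * a k ^ 2 := by rw [hc]; gcongr
      linarith
    have hla0 : 0 ≤ l * a k := mul_nonneg hl0 (ha k)
    have hc1 : |c| ≤ 1 := by
      rw [abs_of_nonneg hc0]
      have : (l * a k) ^ 2 ≤ 1 := pow_le_one₀ hla0 (hla k)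
      linarith
    have hb := norm_exp_mul_I_sub_exp_neg_le hx1 hc1
    have eZ : Z (k + 1) ω = Z k ω * Complex.exp (x * Complex.I) := by
      simp only [hZ]
      rw [← Complex.exp_add]
      congr 1
      simp only [hx, hD]
      push_cast
      ring
    have eE : (E (S k) ω : ℂ) = (E (S (k + 1)) ω : ℂ) * (Real.exp (-c) : ℂ) := by
      rw [← Complex.ofReal_mul]
      congr 1
      simp only [hE]
      rw [← Real.exp_add, hSsucc]
      congr 1
      simp only [hc]
      ring
    -- Taylor remainder, plus the cost of compensating with `V 0` where the conditional variance is
    -- `V k`.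
    have e1 : U (k + 1) ω - U k ω - ξ k ω = W k ω *
        ((Complex.exp (x * Complex.I) - (Real.exp (-c) : ℂ) - (x * Complex.I - x ^ 2 / 2 + c))
          + ((lam ω ^ 2 / 2 * a k ^ 2 * (V 0 ω - V k ω) : ℝ) : ℂ)) := by
      simp only [hU, hξ, hW1, hW2, hW, eZ, Complex.real_smul]
      rw [eE]
      simp only [hD2, hx, hc]
      push_cast
      ring
    have h2 : ‖((lam ω ^ 2 / 2 * a k ^ 2 * (V 0 ω - V k ω) : ℝ) : ℂ)‖
        ≤ l ^ 2 / 2 * a k ^ 2 * Y ω := by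
      rw [Complex.norm_real, Real.norm_eq_abs, abs_mul, abs_of_nonneg (by positivity),
        abs_sub_comm]
      have := hlamsq ω
      exact mul_le_mul (by gcongr) (hVY k ω) (abs_nonneg _) (by positivity)
    -- Since `c ≤ (l a_k)² / 2` and `l a_k ≤ 1`, both terms are at most `(l a_k)³ / 4`; one factor
    -- `a_k` is then bounded by `b`, keeping `a_k²` for the summation.
    have h3 : |x| ^ 3 / 4 + c ^ 2 ≤ l ^ 3 * b * a k ^ 2 := by
      have h4 : |x| ^ 3 ≤ (l * a k) ^ 3 := pow_le_pow_left₀ (abs_nonneg _) hxl 3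
      have h5 : c ^ 2 ≤ ((l * a k) ^ 2 / 2) ^ 2 := pow_le_pow_left₀ hc0 hcl 2
      have h6 : (l * a k) ^ 4 ≤ (l * a k) ^ 3 := pow_le_pow_of_le_one hla0 (hla k) (by norm_num)
      have h7 : (l * a k) ^ 3 ≤ l ^ 3 * b * a k ^ 2 := by
        have : l ^ 3 * a k ^ 2 * a k ≤ l ^ 3 * a k ^ 2 * b :=
          mul_le_mul_of_nonneg_left (hab k) (by positivity)
        calc (l * a k) ^ 3 = l ^ 3 * a k ^ 2 * a k := by ring
          _ ≤ l ^ 3 * a k ^ 2 * b := this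
          _ = _ := by ring
      have h8 : 0 ≤ (l * a k) ^ 3 := by positivity
      have h9 : ((l * a k) ^ 2 / 2) ^ 2 = (l * a k) ^ 4 / 4 := by ring
      linarith
    rw [e1, norm_mul]
    calc ‖W k ω‖ * _ ≤ C * (l ^ 3 * b * a k ^ 2 + l ^ 2 / 2 * a k ^ 2 * Y ω) := by
          refine mul_le_mul (hWn k ω) ?_ (norm_nonneg _) (Real.exp_pos _).le
          exact (norm_add_le _ _).trans (add_le_add (hb.trans h3) h2)
      _ = _ := by ring
  have hY0 : ∀ ω, 0 ≤ Y ω := fun ω => (abs_nonneg _).trans (hVY 0 ω)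
  have hb0 : 0 ≤ b := (ha 0).trans (hab 0)
  set R : Ω → ℝ := fun ω => C * (l ^ 2 * s / 2 * Y ω + l ^ 3 * b * s) with hR
  have hRi : Integrable R P := ((hY.const_mul _).add (integrable_const _)).const_mul _
  have hsum : ∀ m ω, ‖U m ω - 1 - ∑ k ∈ Finset.range m, ξ k ω‖ ≤ R ω := by
    intro m ω
    have hU0 : U 0 ω = 1 := by simp [hU, hZ, hE, hS]
    have e1 : U m ω - 1 - ∑ k ∈ Finset.range m, ξ k ω
        = ∑ k ∈ Finset.range m, (U (k + 1) ω - U k ω - ξ k ω) := by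
      rw [Finset.sum_sub_distrib, Finset.sum_range_sub (fun k => U k ω), hU0]
    rw [e1]
    refine (norm_sum_le _ _).trans ((Finset.sum_le_sum fun k _ => hstep k ω).trans ?_)
    rw [← Finset.mul_sum]
    have h0 : 0 ≤ C * (l ^ 2 / 2 * Y ω + l ^ 3 * b) := by
      have := hY0 ω
      have := (Real.exp_pos (q / 2 * s)).le
      positivity
    calc _ ≤ C * (l ^ 2 / 2 * Y ω + l ^ 3 * b) * s := mul_le_mul_of_nonneg_left (hSs m) h0
      _ = R ω := by simp only [hR]; ring
  have hUi : ∀ m, Integrable (fun ω => U m ω - 1) P := fun m =>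
    (Integrable.of_bound ((hUm m).mono (ℱ.le m) le_rfl).aestronglyMeasurable C
      (ae_of_all _ (hUn m))).sub (integrable_const _)
  have hfin : ∀ m, ∀ᵐ ω ∂P, ‖P[fun ω => U m ω - 1 | ℱ 0] ω‖ ≤ P[R | ℱ 0] ω := by
    intro m
    have hNi : Integrable (fun ω => ∑ k ∈ Finset.range m, ξ k ω) P :=
      integrable_finsetSum _ fun k _ => hξi k
    have hN0 : P[fun ω => ∑ k ∈ Finset.range m, ξ k ω | ℱ 0] =ᵐ[P] 0 := by
      have e1 := condExp_finsetSum (μ := P) (s := Finset.range m) (fun k _ => hξi k) (ℱ 0)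
      have e2 : ∀ᵐ ω ∂P, ∀ k, P[ξ k | ℱ 0] ω = 0 := ae_all_iff.2 fun k => hξ0 k
      have e3 : (∑ k ∈ Finset.range m, ξ k) = fun ω => ∑ k ∈ Finset.range m, ξ k ω := by
        ext ω; simp
      rw [e3] at e1
      filter_upwards [e1, e2] with ω e1 e2
      rw [e1, Finset.sum_apply]
      exact Finset.sum_eq_zero fun k _ => e2 k
    have h1 := condExp_sub (hUi m) hNi (ℱ 0)
    have h2 := norm_condExp_le (μ := P) (m := ℱ 0)
      ((fun ω => U m ω - 1) - fun ω => ∑ k ∈ Finset.range m, ξ k ω)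
    have h3 := condExp_mono (m := ℱ 0) ((hUi m).sub hNi).norm hRi (ae_of_all _ (hsum m))
    filter_upwards [h1, h2, h3, hN0] with ω h1 h2 h3 h4
    rw [Pi.sub_apply, h4, Pi.zero_apply, sub_zero] at h1
    rw [← h1]
    exact h2.trans h3
  set Uinf : Ω → ℂ := fun ω => Complex.exp ((lam ω * (Minf ω - M 0 ω) : ℝ) * Complex.I)
    * (E s ω : ℂ) with hUinf
  have hUlim : ∀ᵐ ω ∂P, Tendsto (fun m => U m ω - 1) atTop (𝓝 (Uinf ω - 1)) := by
    filter_upwards [hlim] with ω hω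
    refine Tendsto.sub_const (Tendsto.mul ?_ ?_) _
    · refine (Complex.continuous_exp.tendsto _).comp (Tendsto.mul_const _ ?_)
      exact (Complex.continuous_ofReal.tendsto _).comp ((hω.sub_const _).const_mul _)
    · exact (Complex.continuous_ofReal.tendsto _).comp
        ((Real.continuous_exp.tendsto _).comp (hSlim.const_mul _))
  -- The conditional expectations converge in `L¹`, hence almost surely along a subsequence, which
  -- is enough to pass to the limit in an inequality.
  have hL1 := tendsto_condExpL1_of_dominated_convergence (μ := P) (ℱ.le 0) (fun _ => C + 1)
    (fun m => (hUi m).aestronglyMeasurable) (integrable_const _)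
    (fun m => ae_of_all _ fun ω => (norm_sub_le _ _).trans (by
      rw [norm_one]; exact add_le_add_left (hUn m ω) 1)) hUlim
  obtain ⟨ns, -, hns⟩ := (tendstoInMeasure_of_tendsto_Lp hL1).exists_seq_tendsto_ae
  have hUinfi : Integrable (fun ω => Uinf ω - 1) P := by
    refine Integrable.of_bound (aestronglyMeasurable_of_tendsto_ae atTop
      (fun m => (hUi m).aestronglyMeasurable) hUlim) (C + 1) (ae_of_all _ fun ω => ?_)
    refine (norm_sub_le _ _).trans ?_
    rw [norm_one, hUinf, norm_mul, Complex.norm_exp_ofReal_mul_I, one_mul, hEn]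
    exact add_le_add_left (hEle s le_rfl ω hs0) 1
  have hc1 : ∀ᵐ ω ∂P, ∀ m, P[fun ω => U m ω - 1 | ℱ 0] ω
      = condExpL1 (ℱ.le 0) P (fun ω => U m ω - 1) ω :=
    ae_all_iff.2 fun m => condExp_ae_eq_condExpL1 (ℱ.le 0) _
  have hc2 := condExp_ae_eq_condExpL1 (μ := P) (ℱ.le 0) (fun ω => Uinf ω - 1)
  filter_upwards [hns, hc1, hc2, ae_all_iff.2 hfin] with ω h1 h2 h3 h4
  refine le_of_tendsto' (x := atTop) (f := fun i => ‖P[fun ω => U (ns i) ω - 1 | ℱ 0] ω‖) ?_ fun i => h4 (ns i)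
  refine Tendsto.norm ?_
  change Tendsto _ _ (𝓝 (P[fun ω => Uinf ω - 1 | ℱ 0] ω))
  rw [h3]
  refine h1.congr fun i => (h2 (ns i)).symm

end ConditionalCLT

/-! ### Tail oscillation and the estimate given the past up to time `n`. -/

section ConditionalCLTLimit

variable {Ω : Type*} {mΩ : MeasurableSpace Ω} {P : Measure Ω} [IsProbabilityMeasure P]

/-- The oscillation of a sequence after time `n`. -/
def tailOscillation (V : ℕ → Ω → ℝ) (n : ℕ) (ω : Ω) : ℝ :=
  ⨆ p : ℕ × ℕ, |V (n + p.1) ω - V (n + p.2) ω|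

lemma measurable_tailOscillation {S : Type*} [MeasurableSpace S] {V : ℕ → S → ℝ}
    (hV : ∀ k, Measurable (V k)) (n : ℕ) : Measurable (tailOscillation V n) :=
  Measurable.iSup fun _ => ((hV _).sub (hV _)).abs

section Oscillation

variable {V : ℕ → Ω → ℝ} (hV0 : ∀ k ω, 0 ≤ V k ω) (hV1 : ∀ k ω, V k ω ≤ 1)
include hV0 hV1

lemma abs_sub_le_one_of_mem (j k : ℕ) (ω : Ω) : |V j ω - V k ω| ≤ 1 := by
  rw [abs_le]
  constructor <;> linarith [hV0 j ω, hV1 j ω, hV0 k ω, hV1 k ω]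

lemma bddAbove_tailOscillation (n : ℕ) (ω : Ω) :
    BddAbove (Set.range fun p : ℕ × ℕ => |V (n + p.1) ω - V (n + p.2) ω|) :=
  ⟨1, by rintro _ ⟨p, rfl⟩; exact abs_sub_le_one_of_mem hV0 hV1 _ _ ω⟩

lemma abs_sub_le_tailOscillation (n : ℕ) (ω : Ω) (j k : ℕ) :
    |V (n + j) ω - V (n + k) ω| ≤ tailOscillation V n ω :=
  le_ciSup (bddAbove_tailOscillation hV0 hV1 n ω) (j, k)

lemma tailOscillation_nonneg (n : ℕ) (ω : Ω) : 0 ≤ tailOscillation V n ω :=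
  (abs_nonneg _).trans (abs_sub_le_tailOscillation hV0 hV1 n ω 0 0)

lemma tailOscillation_le_one (n : ℕ) (ω : Ω) : tailOscillation V n ω ≤ 1 :=
  ciSup_le fun _ => abs_sub_le_one_of_mem hV0 hV1 _ _ ω

lemma tailOscillation_anti {m n : ℕ} (h : m ≤ n) (ω : Ω) :
    tailOscillation V n ω ≤ tailOscillation V m ω := by
  obtain ⟨d, rfl⟩ := Nat.exists_eq_add_of_le h
  refine ciSup_le fun p => ?_
  rw [Nat.add_assoc, Nat.add_assoc]
  exact abs_sub_le_tailOscillation hV0 hV1 m ω _ _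

lemma tendsto_tailOscillation {ω : Ω} {v : ℝ} (h : Tendsto (fun n => V n ω) atTop (𝓝 v)) :
    Tendsto (fun n => tailOscillation V n ω) atTop (𝓝 0) := by
  rw [Metric.tendsto_atTop]
  intro ε hε
  obtain ⟨N, hN⟩ := Metric.tendsto_atTop.1 h (ε / 4) (by positivity)
  refine ⟨N, fun n hn => ?_⟩
  rw [Real.dist_eq, sub_zero, abs_of_nonneg (tailOscillation_nonneg hV0 hV1 n ω)]
  refine lt_of_le_of_lt (ciSup_le fun p => ?_) (half_lt_self hε)
  have h1 := hN (n + p.1) (by omega)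
  have h2 := hN (n + p.2) (by omega)
  rw [Real.dist_eq] at h1 h2
  calc |V (n + p.1) ω - V (n + p.2) ω| ≤ |V (n + p.1) ω - v| + |v - V (n + p.2) ω| :=
        abs_sub_le _ _ _
    _ ≤ ε / 4 + ε / 4 := by rw [abs_sub_comm v]; exact add_le_add h1.le h2.le
    _ = ε / 2 := by ring

/-- A case of Hunt's lemma: the conditional expectations of the tail oscillations vanish. -/
lemma ae_tendsto_condExp_tailOscillation {ℱ : Filtration ℕ mΩ} (hV : ∀ k, Measurable[ℱ k] (V k))
    {Vinf : Ω → ℝ} (hlim : ∀ᵐ ω ∂P, Tendsto (fun n => V n ω) atTop (𝓝 (Vinf ω))) :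
    ∀ᵐ ω ∂P, Tendsto (fun n => P[tailOscillation V n | ℱ n] ω) atTop (𝓝 0) := by
  have hle : ⨆ n, ℱ n ≤ mΩ := iSup_le fun n => ℱ.le n
  have hVs : ∀ k, Measurable[⨆ n, ℱ n] (V k) := fun k => (hV k).mono (le_iSup _ k) le_rfl
  have hTs : ∀ n, Measurable[⨆ n, ℱ n] (tailOscillation V n) := fun n =>
    @measurable_tailOscillation Ω (⨆ n, ℱ n) V hVs n
  have hTi : ∀ n, Integrable (tailOscillation V n) P := fun n =>
    integrable_of_measurable_of_abs_le ((hTs n).mono hle le_rfl) (C := 1) fun ω => by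
      rw [abs_of_nonneg (tailOscillation_nonneg hV0 hV1 n ω)]
      exact tailOscillation_le_one hV0 hV1 n ω
  -- For fixed `N`, Lévy's upward theorem applies, and the oscillation is its own limit because it
  -- is measurable for the limiting σ-algebra. Monotonicity in `n` then bounds the diagonal sequence
  -- by the one at a fixed `N` with small oscillation.
  have h1 : ∀ᵐ ω ∂P, ∀ N, Tendsto (fun n => P[tailOscillation V N | ℱ n] ω) atTop
      (𝓝 (tailOscillation V N ω)) := by
    rw [ae_all_iff]
    intro N
    have := tendsto_ae_condExp (μ := P) (ℱ := ℱ) (tailOscillation V N)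
    rwa [condExp_of_stronglyMeasurable hle (hTs N).stronglyMeasurable (hTi N)] at this
  have h2 : ∀ᵐ ω ∂P, ∀ N n, N ≤ n →
      P[tailOscillation V n | ℱ n] ω ≤ P[tailOscillation V N | ℱ n] ω := by
    simp only [ae_all_iff]
    intro N n hNn
    exact condExp_mono (hTi n) (hTi N) (ae_of_all _ fun ω => tailOscillation_anti hV0 hV1 hNn ω)
  have h3 : ∀ᵐ ω ∂P, ∀ n, 0 ≤ P[tailOscillation V n | ℱ n] ω :=
    ae_all_iff.2 fun n => condExp_nonneg (ae_of_all _ fun ω => tailOscillation_nonneg hV0 hV1 n ω)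
  filter_upwards [h1, h2, h3, hlim] with ω h1 h2 h3 h4
  rw [Metric.tendsto_atTop]
  intro ε hε
  obtain ⟨N, hN⟩ := ((tendsto_tailOscillation hV0 hV1 h4).eventually_lt_const hε).exists
  obtain ⟨K, hK⟩ := eventually_atTop.1 ((h1 N).eventually_lt_const hN)
  refine ⟨max N K, fun n hn => ?_⟩
  rw [Real.dist_eq, sub_zero, abs_of_nonneg (h3 n)]
  exact (h2 N n (le_trans (le_max_left _ _) hn)).trans_lt (hK n (le_trans (le_max_right _ _) hn))

end Oscillation

/-- The filtration started at time `n`. -/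
def shiftFiltration (ℱ : Filtration ℕ mΩ) (n : ℕ) : Filtration ℕ mΩ where
  seq k := ℱ (n + k)
  mono' _ _ h := ℱ.mono (Nat.add_le_add_left h n)
  le' k := ℱ.le (n + k)

variable {ℱ : Filtration ℕ mΩ} {M V : ℕ → Ω → ℝ} {a : ℕ → ℝ} {Minf : Ω → ℝ}
  {κ : ℕ → Ω → Measure ℝ}

/-- The conditional central limit estimate given the past up to time `n`, in terms of the
conditional distributions `κ n` of the limit. -/
lemma norm_integral_exp_sub_one_le
    (hM : ∀ k, Measurable[ℱ k] (M k)) (hV : ∀ k, Measurable[ℱ k] (V k))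
    (hV0 : ∀ k ω, 0 ≤ V k ω) (hV1 : ∀ k ω, V k ω ≤ 1) (ha : ∀ k, 0 ≤ a k)
    (hinc : ∀ k ω, |M (k + 1) ω - M k ω| ≤ a (k + 1))
    (hE1 : ∀ k, P[fun ω => M (k + 1) ω - M k ω | ℱ k] =ᵐ[P] 0)
    (hE2 : ∀ k, P[fun ω => (M (k + 1) ω - M k ω) ^ 2 | ℱ k] =ᵐ[P]
      fun ω => a (k + 1) ^ 2 * V k ω)
    (hMinf : AEStronglyMeasurable Minf P)
    (hlim : ∀ᵐ ω ∂P, Tendsto (fun k => M k ω) atTop (𝓝 (Minf ω)))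
    (hs : Summable fun k => a k ^ 2)
    (hκ : ∀ n (lam : Ω → ℝ), Measurable[ℱ n] lam →
      P[fun ω => Complex.exp ((lam ω * (Minf ω - M n ω) : ℝ) * Complex.I) | ℱ n] =ᵐ[P]
        fun ω => ∫ y, Complex.exp ((lam ω * (y - M n ω) : ℝ) * Complex.I) ∂(κ n ω))
    (n : ℕ) {lam : Ω → ℝ} {q l b : ℝ} (hab : ∀ k, a (n + k + 1) ≤ b)
    (hlam : Measurable[ℱ n] lam) (hq : ∀ ω, lam ω ^ 2 * V n ω ≤ q) (hl : ∀ ω, |lam ω| ≤ l)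
    (hlb : l * b ≤ 1) :
    ∀ᵐ ω ∂P, ‖(∫ y, Complex.exp ((lam ω * (y - M n ω) : ℝ) * Complex.I) ∂(κ n ω))
        * (Real.exp (lam ω ^ 2 * V n ω / 2 * ∑' k, a (n + k + 1) ^ 2) : ℂ) - 1‖
      ≤ Real.exp (q / 2 * ∑' k, a (n + k + 1) ^ 2) *
          (l ^ 2 * (∑' k, a (n + k + 1) ^ 2) / 2 * P[tailOscillation V n | ℱ n] ω
            + l ^ 3 * b * ∑' k, a (n + k + 1) ^ 2) := by
  have hs' : Summable fun k => a (n + k + 1) ^ 2 := by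
    refine ((summable_nat_add_iff (n + 1)).2 hs).congr fun k => ?_
    rw [show k + (n + 1) = n + k + 1 by ring]
  have hTm : Measurable (tailOscillation V n) :=
    measurable_tailOscillation (fun k => (hV k).mono (ℱ.le k) le_rfl) n
  have hTi : Integrable (tailOscillation V n) P :=
    integrable_of_measurable_of_abs_le hTm (C := 1) fun ω => by
      rw [abs_of_nonneg (tailOscillation_nonneg hV0 hV1 n ω)]
      exact tailOscillation_le_one hV0 hV1 n ω
  have hmain := norm_condExp_exp_sub_one_le (P := P) (ℱ := shiftFiltration ℱ n)
    (M := fun k => M (n + k)) (V := fun k => V (n + k)) (a := fun k => a (n + k + 1))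
    (Minf := Minf) (lam := lam) (Y := tailOscillation V n) (q := q) (l := l) (b := b)
    (fun k => hM (n + k)) (fun k => hV (n + k)) (fun k => hV0 (n + k)) (fun k => hV1 (n + k))
    (fun k => ha _) hab (fun k => hinc (n + k)) (fun k => hE1 (n + k)) (fun k => hE2 (n + k))
    (by
      filter_upwards [hlim] with ω hω
      exact (tendsto_add_atTop_iff_nat (f := fun k => M k ω) n).2 hω |>.congr fun k => by
        rw [Nat.add_comm])
    hlam hq hl hs' hlb hTi (fun k ω => abs_sub_le_tailOscillation hV0 hV1 n ω k 0)
  set s := ∑' k, a (n + k + 1) ^ 2 with hsdef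
  have hs0 : 0 ≤ s := tsum_nonneg fun k => sq_nonneg _
  set Z : Ω → ℂ := fun ω => Complex.exp ((lam ω * (Minf ω - M n ω) : ℝ) * Complex.I) with hZ
  set e : Ω → ℝ := fun ω => Real.exp (lam ω ^ 2 * V n ω / 2 * s) with he
  have hlam' : Measurable lam := hlam.mono (ℱ.le n) le_rfl
  have hZm : AEStronglyMeasurable Z P := by
    have h1 : AEMeasurable Minf P := hMinf.aemeasurable
    have h2 : Measurable (M n) := (hM n).mono (ℱ.le n) le_rfl
    exact (Complex.measurable_exp.comp_aemeasurable ((Complex.measurable_ofReal.comp_aemeasurable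
      (hlam'.aemeasurable.mul (h1.sub h2.aemeasurable))).mul_const _)).aestronglyMeasurable
  have hZi : Integrable Z P :=
    Integrable.of_bound hZm 1 (ae_of_all _ fun ω => (Complex.norm_exp_ofReal_mul_I _).le)
  have hem : Measurable[ℱ n] e := ((((hlam.pow_const 2).mul (hV n)).div_const 2).mul_const s).exp
  have heb : ∀ ω, ‖e ω‖ ≤ Real.exp (q / 2 * s) := fun ω => by
    rw [Real.norm_eq_abs, abs_of_pos (Real.exp_pos _)]
    exact Real.exp_le_exp.2 (mul_le_mul_of_nonneg_right (by linarith [hq ω]) hs0)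
  have heZ : Integrable (e • Z) P :=
    hZi.bdd_smul _ (hem.mono (ℱ.le n) le_rfl).aestronglyMeasurable (ae_of_all _ heb)
  -- The frozen compensator is known at time `n` and leaves the conditional expectation, so that
  -- only the characteristic function of `κ n` remains inside.
  have h1 := condExp_smul_of_aestronglyMeasurable_left (μ := P) (m := ℱ n)
    hem.stronglyMeasurable.aestronglyMeasurable heZ hZi
  have h2 := condExp_sub heZ (integrable_const (1 : ℂ)) (μ := P) (ℱ n)
  have h3 : (fun ω => Z ω * (e ω : ℂ) - 1) = e • Z - fun _ => (1 : ℂ) := by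
    ext ω
    simp [mul_comm]
  have h4 := condExp_add (μ := P) (hTi.const_mul (Real.exp (q / 2 * s) * (l ^ 2 * s / 2)))
    (integrable_const (Real.exp (q / 2 * s) * (l ^ 3 * b * s))) (ℱ n)
  have h5 := condExp_smul (μ := P) (Real.exp (q / 2 * s) * (l ^ 2 * s / 2)) (tailOscillation V n) (ℱ n)
  have h6 : (fun ω => Real.exp (q / 2 * s) * (l ^ 2 * s / 2 * tailOscillation V n ω + l ^ 3 * b * s))
      = (fun ω => Real.exp (q / 2 * s) * (l ^ 2 * s / 2) * tailOscillation V n ω)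
        + fun _ => Real.exp (q / 2 * s) * (l ^ 3 * b * s) := by
    ext ω
    simp only [Pi.add_apply]
    ring
  have hmain' : ∀ᵐ ω ∂P, ‖P[fun ω => Z ω * (e ω : ℂ) - 1 | ℱ n] ω‖
      ≤ P[fun ω => Real.exp (q / 2 * s) *
          (l ^ 2 * s / 2 * tailOscillation V n ω + l ^ 3 * b * s) | ℱ n] ω := hmain
  rw [h3, h6] at hmain'
  filter_upwards [hmain', h1, h2, h4, h5, hκ n lam hlam] with ω hm h1 h2 h4 h5 h7
  rw [h2, h4, Pi.sub_apply, h1, Pi.add_apply, condExp_const (ℱ.le n), condExp_const (ℱ.le n),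
    Pi.smul_apply', h7] at hm
  have h5' : P[fun ω => Real.exp (q / 2 * s) * (l ^ 2 * s / 2) * tailOscillation V n ω | ℱ n] ω
      = Real.exp (q / 2 * s) * (l ^ 2 * s / 2) * P[tailOscillation V n | ℱ n] ω := h5
  rw [h5', Complex.real_smul, mul_comm (e ω : ℂ)] at hm
  refine hm.trans_eq ?_
  ring

end ConditionalCLTLimit

/-! ### From the estimate to almost sure conditional convergence. -/

section ConditionalCLTConvergence

/-- Each conditional estimate holds outside a null set depending on `t`, so it is used for rational
`t` only and extended by continuity. The strict inequality on `t` makes nearby rationals admissible.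
-/
lemma le_of_forall_rat_le {g h : ℝ → ℝ} (hg : Continuous g) (hh : Continuous h) {C : ℝ}
    (H : ∀ q : ℚ, |(q : ℝ)| * C ≤ 1 → g q ≤ h q) {t : ℝ} (ht : |t| * C < 1) : g t ≤ h t := by
  obtain ⟨u, hu, hut⟩ := mem_closure_iff_seq_limit.1 (Rat.denseRange_cast (𝕜 := ℝ) t)
  refine le_of_tendsto_of_tendsto ((hg.tendsto t).comp hut) ((hh.tendsto t).comp hut) ?_
  have h1 : Tendsto (fun n => |u n| * C) atTop (𝓝 (|t| * C)) := hut.abs.mul_const C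
  filter_upwards [h1.eventually_lt_const ht] with n hn
  obtain ⟨q, hq⟩ := hu n
  simp only [Function.comp_apply, ← hq]
  rw [← hq] at hn
  exact H q hn.le

lemma continuous_integral_exp_mul_I (ν : Measure ℝ) [IsFiniteMeasure ν] (d m : ℝ) :
    Continuous fun t : ℝ => ∫ y, Complex.exp ((t * d * (y - m) : ℝ) * Complex.I) ∂ν := by
  refine continuous_of_dominated (bound := fun _ => 1) (fun t => ?_) (fun t => ?_)
    (integrable_const _) (ae_of_all _ fun y => ?_)
  · exact Continuous.aestronglyMeasurable (by fun_prop)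
  · exact ae_of_all _ fun y => (Complex.norm_exp_ofReal_mul_I _).le
  · fun_prop

variable {Ω : Type*} {mΩ : MeasurableSpace Ω} {P : Measure Ω} [IsProbabilityMeasure P]
  {ℱ : Filtration ℕ mΩ} {M V : ℕ → Ω → ℝ} {a : ℕ → ℝ} {Minf Vinf : Ω → ℝ}
  {κ : ℕ → Ω → Measure ℝ}

/-- Almost sure conditional central limit theorem for the limit of a bounded martingale, in terms
of characteristic functions. -/
theorem ae_tendsto_integral_exp [∀ n ω, IsProbabilityMeasure (κ n ω)]
    (hM : ∀ k, Measurable[ℱ k] (M k)) (hV : ∀ k, Measurable[ℱ k] (V k))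
    (hV0 : ∀ k ω, 0 ≤ V k ω) (hV1 : ∀ k ω, V k ω ≤ 1) (ha : ∀ k, 0 ≤ a k)
    (hinc : ∀ k ω, |M (k + 1) ω - M k ω| ≤ a (k + 1))
    (hE1 : ∀ k, P[fun ω => M (k + 1) ω - M k ω | ℱ k] =ᵐ[P] 0)
    (hE2 : ∀ k, P[fun ω => (M (k + 1) ω - M k ω) ^ 2 | ℱ k] =ᵐ[P]
      fun ω => a (k + 1) ^ 2 * V k ω)
    (hMinf : AEStronglyMeasurable Minf P)
    (hlim : ∀ᵐ ω ∂P, Tendsto (fun k => M k ω) atTop (𝓝 (Minf ω)))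
    (hVlim : ∀ᵐ ω ∂P, Tendsto (fun k => V k ω) atTop (𝓝 (Vinf ω)))
    (hs : Summable fun k => a k ^ 2)
    (hκ : ∀ n (lam : Ω → ℝ), Measurable[ℱ n] lam →
      P[fun ω => Complex.exp ((lam ω * (Minf ω - M n ω) : ℝ) * Complex.I) | ℱ n] =ᵐ[P]
        fun ω => ∫ y, Complex.exp ((lam ω * (y - M n ω) : ℝ) * Complex.I) ∂(κ n ω))
    {b c : ℕ → ℝ} (hab : ∀ n k, a (n + k + 1) ≤ b n) (hc : ∀ n, 0 ≤ c n)
    (hcs : Tendsto (fun n => c n ^ 2 * ∑' k, a (n + k + 1) ^ 2) atTop (𝓝 1))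
    (hcb : Tendsto (fun n => c n * b n) atTop (𝓝 0)) :
    ∀ᵐ ω ∂P, 0 < Vinf ω → ∀ t : ℝ,
      Tendsto (fun n => ∫ y, Complex.exp ((t * (c n / √(V n ω)) * (y - M n ω) : ℝ) * Complex.I)
        ∂(κ n ω)) atTop (𝓝 (Real.exp (-(t ^ 2 / 2)) : ℂ)) := by
  set s : ℕ → ℝ := fun n => ∑' k, a (n + k + 1) ^ 2 with hsdef
  have hb0 : ∀ n, 0 ≤ b n := fun n => (ha _).trans (hab n 0)
  -- Truncating `V n` from below by `ε` bounds the multiplier, as the estimate requires, and still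
  -- keeps `(q d)² V n ≤ q² c²`.
  set d : ℕ → ℝ → Ω → ℝ := fun n ε ω => c n / √(max (V n ω) ε) with hd
  have hrat : ∀ᵐ ω ∂P, ∀ (n m : ℕ) (q : ℚ), |(q : ℝ)| * (c n / √(1 / ((m : ℝ) + 1)) * b n) ≤ 1 →
      ‖(∫ y, Complex.exp ((q * d n (1 / ((m : ℝ) + 1)) ω * (y - M n ω) : ℝ) * Complex.I) ∂(κ n ω))
        * (Real.exp ((q * d n (1 / ((m : ℝ) + 1)) ω) ^ 2 * V n ω / 2 * s n) : ℂ) - 1‖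
      ≤ Real.exp (((q : ℝ) ^ 2 * c n ^ 2) / 2 * s n) *
        ((|(q : ℝ)| * (c n / √(1 / ((m : ℝ) + 1)))) ^ 2 * s n / 2 * P[tailOscillation V n | ℱ n] ω
          + (|(q : ℝ)| * (c n / √(1 / ((m : ℝ) + 1)))) ^ 3 * b n * s n) := by
    simp only [ae_all_iff]
    intro n m q hqb
    have hε : (0 : ℝ) < 1 / ((m : ℝ) + 1) := by positivity
    refine norm_integral_exp_sub_one_le hM hV hV0 hV1 ha hinc hE1 hE2 hMinf hlim hs hκ n
      (lam := fun ω => q * d n (1 / ((m : ℝ) + 1)) ω) (hab n) ?_ (fun ω => ?_) (fun ω => ?_) ?_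
    · exact (((hV n).max measurable_const).sqrt.const_div _).const_mul _
    · have hmax : 0 < max (V n ω) (1 / ((m : ℝ) + 1)) := lt_max_of_lt_right hε
      have h1 : V n ω / max (V n ω) (1 / ((m : ℝ) + 1)) ≤ 1 :=
        div_le_one_of_le₀ (le_max_left _ _) hmax.le
      have h2 : (q * d n (1 / ((m : ℝ) + 1)) ω) ^ 2 * V n ω
          = (q : ℝ) ^ 2 * c n ^ 2 * (V n ω / max (V n ω) (1 / ((m : ℝ) + 1))) := by
        simp only [hd]
        rw [mul_pow, div_pow, Real.sq_sqrt hmax.le]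
        ring
      rw [h2]
      exact mul_le_of_le_one_right (by positivity) h1
    · rw [abs_mul, hd]
      simp only
      rw [abs_of_nonneg (div_nonneg (hc n) (Real.sqrt_nonneg _))]
      refine mul_le_mul_of_nonneg_left ?_ (abs_nonneg _)
      exact div_le_div_of_nonneg_left (hc n) (Real.sqrt_pos.2 hε)
        (Real.sqrt_le_sqrt (le_max_right _ _))
    · rw [mul_assoc]; exact hqb
  filter_upwards [hrat, hVlim, ae_tendsto_condExp_tailOscillation hV0 hV1 hV hVlim]
    with ω hrat hVω hTω hpos t
  -- On `Vinf > 0` some level `1/(m+1)` lies below the limit, hence eventually below `V n`, and the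
  -- truncation at that level is inactive.
  obtain ⟨m, hm⟩ := exists_nat_one_div_lt hpos
  set ε : ℝ := 1 / ((m : ℝ) + 1) with hε
  have hε0 : 0 < ε := by positivity
  have hsε : 0 < √ε := Real.sqrt_pos.2 hε0
  have hVε : ∀ᶠ n in atTop, ε < V n ω := hVω.eventually_const_lt hm
  have hb1 : ∀ᶠ n in atTop, |t| * (c n / √ε * b n) < 1 := by
    have h1 : Tendsto (fun n => |t| * (c n / √ε * b n)) atTop (𝓝 0) := by
      have := hcb.const_mul (|t| / √ε)
      rw [mul_zero] at this
      exact this.congr fun n => by ring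
    exact h1.eventually_lt_const one_pos
  have hbound : ∀ᶠ n in atTop,
      ‖(∫ y, Complex.exp ((t * (c n / √(V n ω)) * (y - M n ω) : ℝ) * Complex.I) ∂(κ n ω))
        * (Real.exp (t ^ 2 / 2 * (c n ^ 2 * s n)) : ℂ) - 1‖
      ≤ Real.exp (t ^ 2 / 2 * (c n ^ 2 * s n)) *
        (t ^ 2 / (2 * ε) * (c n ^ 2 * s n) * P[tailOscillation V n | ℱ n] ω
          + |t| ^ 3 / √ε ^ 3 * (c n * b n) * (c n ^ 2 * s n)) := by
    filter_upwards [hVε, hb1] with n hn hbn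
    have hd' : d n ε ω = c n / √(V n ω) := by simp only [hd]; rw [max_eq_left hn.le]
    have hVn : 0 < V n ω := hε0.trans hn
    have key := le_of_forall_rat_le (C := c n / √ε * b n)
      (g := fun t => ‖(∫ y, Complex.exp ((t * d n ε ω * (y - M n ω) : ℝ) * Complex.I) ∂(κ n ω))
        * (Real.exp ((t * d n ε ω) ^ 2 * V n ω / 2 * s n) : ℂ) - 1‖)
      (h := fun t => Real.exp ((t ^ 2 * c n ^ 2) / 2 * s n) *
        ((|t| * (c n / √ε)) ^ 2 * s n / 2 * P[tailOscillation V n | ℱ n] ω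
          + (|t| * (c n / √ε)) ^ 3 * b n * s n))
      (by
        have h1 := continuous_integral_exp_mul_I (κ n ω) (d n ε ω) (M n ω)
        have h2 : Continuous fun t : ℝ => (Real.exp ((t * d n ε ω) ^ 2 * V n ω / 2 * s n) : ℂ) := by
          fun_prop
        exact ((h1.mul h2).sub continuous_const).norm)
      (by fun_prop) (fun q hq => hrat n m q hq) hbn
    simp only [hd'] at key
    have e1 : (t * (c n / √(V n ω))) ^ 2 * V n ω / 2 * s n = t ^ 2 / 2 * (c n ^ 2 * s n) := by
      rw [mul_pow, div_pow, Real.sq_sqrt hVn.le]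
      field_simp
    have e2 : (t ^ 2 * c n ^ 2) / 2 * s n = t ^ 2 / 2 * (c n ^ 2 * s n) := by ring
    have e3 : (|t| * (c n / √ε)) ^ 2 * s n / 2 = t ^ 2 / (2 * ε) * (c n ^ 2 * s n) := by
      rw [mul_pow, div_pow, Real.sq_sqrt hε0.le, sq_abs]
      field_simp
    have e4 : (|t| * (c n / √ε)) ^ 3 * b n * s n
        = |t| ^ 3 / √ε ^ 3 * (c n * b n) * (c n ^ 2 * s n) := by
      rw [mul_pow, div_pow]
      ring
    rw [e1, e2, e3, e4] at key
    exact key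
  have hexp : Tendsto (fun n => Real.exp (t ^ 2 / 2 * (c n ^ 2 * s n))) atTop
      (𝓝 (Real.exp (t ^ 2 / 2))) := by
    have := (Real.continuous_exp.tendsto _).comp (hcs.const_mul (t ^ 2 / 2))
    rwa [mul_one] at this
  have hzero : Tendsto (fun n =>
      (∫ y, Complex.exp ((t * (c n / √(V n ω)) * (y - M n ω) : ℝ) * Complex.I) ∂(κ n ω))
        * (Real.exp (t ^ 2 / 2 * (c n ^ 2 * s n)) : ℂ) - 1) atTop (𝓝 0) := by
    rw [tendsto_zero_iff_norm_tendsto_zero]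
    refine squeeze_zero' (Eventually.of_forall fun _ => norm_nonneg _) hbound ?_
    have h1 := ((hcs.const_mul (t ^ 2 / (2 * ε))).mul hTω)
    have h2 := ((hcb.const_mul (|t| ^ 3 / √ε ^ 3)).mul hcs)
    have h3 := hexp.mul (h1.add h2)
    simpa using h3
  have hinv : Tendsto (fun n => (Real.exp (-(t ^ 2 / 2 * (c n ^ 2 * s n))) : ℂ)) atTop
      (𝓝 (Real.exp (-(t ^ 2 / 2)) : ℂ)) := by
    refine (Complex.continuous_ofReal.tendsto _).comp ?_
    have := (Real.continuous_exp.tendsto _).comp (hcs.const_mul (t ^ 2 / 2)).neg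
    rwa [mul_one] at this
  have hfin := (hzero.add_const 1).mul hinv
  rw [zero_add, one_mul] at hfin
  refine hfin.congr fun n => ?_
  rw [sub_add_cancel, mul_assoc, ← Complex.ofReal_mul, ← Real.exp_add, add_neg_cancel,
    Real.exp_zero, Complex.ofReal_one, mul_one]

/-- Weak convergence version of the almost sure conditional central limit theorem. -/
lemma tendsto_map_gaussianReal {ν : ℕ → Measure ℝ} [∀ n, IsProbabilityMeasure (ν n)]
    {d m : ℕ → ℝ}
    (h : ∀ t : ℝ, Tendsto (fun n => ∫ y, Complex.exp ((t * d n * (y - m n) : ℝ) * Complex.I) ∂(ν n))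
      atTop (𝓝 (Real.exp (-(t ^ 2 / 2)) : ℂ))) {s : Set ℝ}
    (hfr : gaussianReal 0 1 (frontier s) = 0) :
    Tendsto (fun n => ((ν n).map fun y => d n * (y - m n)).real s) atTop
      (𝓝 ((gaussianReal 0 1).real s)) := by
  have hmeas : ∀ n, Measurable fun y => d n * (y - m n) := fun n => by fun_prop
  have hprob : ∀ n, IsProbabilityMeasure ((ν n).map fun y => d n * (y - m n)) := fun n =>
    Measure.isProbabilityMeasure_map (hmeas n).aemeasurable
  let η : ℕ → ProbabilityMeasure ℝ := fun n => ⟨(ν n).map fun y => d n * (y - m n), hprob n⟩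
  let γ : ProbabilityMeasure ℝ := ⟨gaussianReal 0 1, inferInstance⟩
  have hη : Tendsto η atTop (𝓝 γ) := by
    rw [ProbabilityMeasure.tendsto_iff_tendsto_charFun]
    intro t
    have e1 : charFun (γ : Measure ℝ) t = (Real.exp (-(t ^ 2 / 2)) : ℂ) := by
      change charFun (gaussianReal 0 1) t = _
      rw [charFun_gaussianReal]
      push_cast
      congr 1
      simp
    rw [e1]
    refine (h t).congr fun n => ?_
    change _ = charFun ((ν n).map fun y => d n * (y - m n)) t
    rw [charFun_apply_real, integral_map (hmeas n).aemeasurable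
      (Continuous.aestronglyMeasurable (by fun_prop))]
    refine integral_congr_ae (ae_of_all _ fun y => ?_)
    simp only
    congr 1
    push_cast
    ring
  have := ProbabilityMeasure.tendsto_measure_of_null_frontier_of_tendsto' hη (E := s) hfr
  exact (ENNReal.tendsto_toReal (measure_ne_top _ _)).comp this

end ConditionalCLTConvergence

/-! ### Gaussian limit and credible intervals for Newton's rule. -/

section GaussianLimit

/-- The conditional distribution of a function of the conditioning variable and another one. -/
lemma ae_condDistrib_comp_prod {Ω S : Type*} [MeasurableSpace Ω] [MeasurableSpace S]
    {P : Measure Ω} [IsFiniteMeasure P] {W : Ω → S} (hW : Measurable W) {Y : Ω → ℝ}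
    (hY : AEMeasurable Y P) {φ : S × ℝ → ℝ} (hφ : Measurable φ) :
    ∀ᵐ ω ∂P, condDistrib (fun ω => φ (W ω, Y ω)) W P (W ω)
      = (condDistrib Y W P (W ω)).map fun y => φ (W ω, y) := by
  set κ := condDistrib Y W P with hκ
  -- The kernel `w ↦` image of `κ w` under `φ (w, ·)` disintegrates the joint law, so essential
  -- uniqueness identifies it.
  set κ' : Kernel S ℝ := (Kernel.id ×ₖ κ).map φ with hκ'
  have hφm : ∀ w, Measurable fun y => φ (w, y) := fun w => hφ.comp measurable_prodMk_left
  have hκ'_apply : ∀ w, κ' w = (κ w).map fun y => φ (w, y) := fun w => by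
    rw [hκ', Kernel.map_apply _ hφ, Kernel.prod_apply, Kernel.id_apply, Measure.dirac_prod,
      Measure.map_map hφ measurable_prodMk_left]
    rfl
  have hκ'_fin : IsFiniteKernel κ' := Kernel.IsFiniteKernel.map _ _
  have hmap : P.map (fun ω => (W ω, φ (W ω, Y ω))) = P.map W ⊗ₘ κ' := by
    have hg : Measurable fun p : S × ℝ => (p.1, φ p) := measurable_fst.prodMk hφ
    have e1 : P.map (fun ω => (W ω, φ (W ω, Y ω)))
        = (P.map fun ω => (W ω, Y ω)).map fun p => (p.1, φ p) := by
      rw [AEMeasurable.map_map_of_aemeasurable hg.aemeasurable (hW.aemeasurable.prodMk hY)]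
      rfl
    ext s hs
    rw [e1, Measure.map_apply hg hs, ← compProd_map_condDistrib hY,
      Measure.compProd_apply (hg hs), Measure.compProd_apply hs]
    refine lintegral_congr fun w => ?_
    rw [hκ'_apply, Measure.map_apply (hφm w) (measurable_prodMk_left hs)]
    rfl
  have h := condDistrib_ae_eq_of_measure_eq_compProd W
    (hφ.comp_aemeasurable (hW.aemeasurable.prodMk hY)) hmap
  filter_upwards [ae_of_ae_map hW.aemeasurable h] with ω hω
  rw [← hκ'_apply]
  exact hω

/-- By symmetry `(-∞, -z]` has mass `γ/2`. The quantile is positive, since otherwise `1 - γ/2 ≤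
γ/2`, contrary to `γ < 1`. -/
lemma gaussianReal_real_Ioo {γ z : ℝ} (hγ1 : γ < 1)
    (hz : cdf (gaussianReal 0 1) z = 1 - γ / 2) :
    (gaussianReal 0 1).real (Set.Ioo (-z) z) = 1 - γ := by
  have : NullSingletonClass (gaussianReal 0 1) := nullSingletonClass_gaussianReal one_ne_zero
  rw [cdf_eq_real] at hz
  have hsymm : (gaussianReal 0 1).real (Set.Iic (-z)) = 1 - (gaussianReal 0 1).real (Set.Iic z) := by
    have h1 : (gaussianReal 0 1).map (fun x => -x) = gaussianReal 0 1 := by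
      rw [gaussianReal_map_neg, neg_zero]
    have h2 : (fun x : ℝ => -x) ⁻¹' Set.Iic (-z) = (Set.Iio z)ᶜ := by
      ext x
      simp
    rw [← h1, map_measureReal_apply (by fun_prop) measurableSet_Iic, h2,
      probReal_compl_eq_one_sub measurableSet_Iio, h1, measureReal_congr Iio_ae_eq_Iic]
  have hpos : -z < z := by
    by_contra hcon
    have h3 : (gaussianReal 0 1).real (Set.Iic z) ≤ (gaussianReal 0 1).real (Set.Iic (-z)) :=
      measureReal_mono (Set.Iic_subset_Iic.2 (not_lt.1 hcon))
    linarith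
  have h4 : Set.Ioc (-z) z = Set.Iic z \ Set.Iic (-z) := by
    ext x
    simp [and_comm]
  rw [measureReal_congr Ioo_ae_eq_Ioc, h4, measureReal_sdiff (Set.Iic_subset_Iic.2 hpos.le)
    measurableSet_Iic, hsymm, hz]
  ring

variable {𝕏 Θ Ω : Type*} [MeasurableSpace 𝕏] [MeasurableSpace Θ] [MeasurableSpace Ω]
  [StandardBorelSpace 𝕏] [Nonempty 𝕏] [StandardBorelSpace Θ] [Nonempty Θ]
  {P : Measure Ω} [IsProbabilityMeasure P] {μ : Measure 𝕏} [SigmaFinite μ] {f : 𝕏 → Θ → ℝ≥0}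
  {G0 : ProbabilityMeasure Θ} {α : ℕ → Set.Ioo (0 : ℝ) 1} {X : ℕ → Ω → 𝕏} {θ : ℕ → Ω → Θ}

lemma measurable_plugInVariance_finiteRule (hf : Measurable (Function.uncurry f))
    (hf_density : ∀ θ, ∫⁻ x, (f x θ : ℝ≥0∞) ∂μ = 1) {A : Set Θ} (hA : MeasurableSet A) (n : ℕ) :
    Measurable fun v : Fin n → 𝕏 => plugInVariance μ f A (finiteRule f G0 α n v) := by
  have : IsMarkovKernel (predictiveKernel μ hf G0 α n) :=
    ⟨fun v => isProbabilityMeasure_mixLaw hf hf_density _⟩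
  have h1 : Measurable fun p : (Fin n → 𝕏) × 𝕏 =>
      (bayesUpdate f (finiteRule f G0 α n p.1) p.2 : Measure Θ).real A ^ 2 :=
    (((Measure.measurable_coe hA).comp
      (measurable_bayesUpdate hf (measurable_finiteRule hf G0 α n))).ennreal_toReal).pow_const 2
  exact (h1.stronglyMeasurable.integral_kernel_prod_right'
    (κ := predictiveKernel μ hf G0 α n)).measurable.sub
    ((measurable_finiteRule_real hf hA n).pow_const 2)

/-- The conditional central limit theorem for Newton's rule, for rates `r n` equivalent to the
inverse of the tail sums of the squared weights. -/
theorem IsNewtonModel.ae_tendsto_map_condDistrib (hmodel : IsNewtonModel μ f G0 α P X θ)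
    (hf : Measurable (Function.uncurry f)) (hf_density : ∀ θ, ∫⁻ x, (f x θ : ℝ≥0∞) ∂μ = 1)
    {G : Ω → ProbabilityMeasure Θ} (hG : Measurable fun ω => (G ω : Measure Θ))
    (hlim : ∀ A, MeasurableSet A → ∀ᵐ ω ∂P,
      Tendsto (fun n => (finiteRule f G0 α n (upTo X n ω) : Measure Θ) A) atTop
        (𝓝 ((G ω : Measure Θ) A)))
    {r : ℕ → ℝ} (hs : Summable fun n => (α n : ℝ) ^ 2)
    (hrs : Tendsto (fun n => r n * ∑' k, (α (n + k + 1) : ℝ) ^ 2) atTop (𝓝 1))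
    (hrb : Tendsto (fun n => √(r n) * ⨆ k, (α (n + k) : ℝ)) atTop (𝓝 0))
    {A : Set Θ} (hA : MeasurableSet A) :
    ∀ᵐ ω ∂P, 0 < plugInVariance μ f A (G ω) → ∀ s, gaussianReal 0 1 (frontier s) = 0 →
      Tendsto (fun n => ((condDistrib (fun ω => (G ω : Measure Θ).real A) (upTo X n) P
        (upTo X n ω)).map fun y =>
          √(r n) / √(plugInVariance μ f A (finiteRule f G0 α n (upTo X n ω))) *
            (y - (finiteRule f G0 α n (upTo X n ω) : Measure Θ).real A)).real s) atTop
        (𝓝 ((gaussianReal 0 1).real s)) := by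
  have hX := hmodel.measurable_obs
  set ℱ := obsFiltration X hX with hℱ
  set Minf : Ω → ℝ := fun ω => (G ω : Measure Θ).real A with hMinf
  have hMinfm : Measurable Minf := ((Measure.measurable_coe hA).comp hG).ennreal_toReal
  set V : ℕ → Ω → ℝ := fun n ω => plugInVariance μ f A (finiteRule f G0 α n (upTo X n ω)) with hV
  -- Positivity is needed for `√(r n) ^ 2 = r n`; it follows for large `n` from the limit of `r n`
  -- times a nonnegative tail sum.
  have hr0 : ∀ᶠ n in atTop, 0 < r n := by
    filter_upwards [hrs.eventually_const_lt one_pos] with n hn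
    exact pos_of_mul_pos_left hn (tsum_nonneg fun _ => sq_nonneg _)
  have hbdd : ∀ n, BddAbove (Set.range fun k => (α (n + k) : ℝ)) := fun n =>
    ⟨1, by rintro _ ⟨k, rfl⟩; exact (α (n + k)).2.2.le⟩
  have hmain := ae_tendsto_integral_exp (P := P) (ℱ := ℱ) (M := ruleMass f G0 α X A) (V := V)
    (a := fun n => (α n : ℝ)) (Minf := Minf) (Vinf := fun ω => plugInVariance μ f A (G ω))
    (κ := fun n ω => condDistrib Minf (upTo X n) P (upTo X n ω))
    (b := fun n => ⨆ k, (α (n + k) : ℝ)) (c := fun n => √(r n))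
    (fun k => measurable_ruleMass hX hf hA k)
    (fun k => (measurable_plugInVariance_finiteRule hf hf_density hA k).comp (comap_measurable _))
    (fun k ω => (plugInVariance_mem_Icc hf hf_density _ hA).1)
    (fun k ω => (plugInVariance_mem_Icc hf hf_density _ hA).2)
    (fun k => (α k).2.1.le) (fun k ω => abs_ruleMass_succ_sub_le A k ω)
    (condExp_ruleMass_succ_sub hmodel hf hf_density hA)
    (condExp_sq_ruleMass_succ_sub hmodel hf hf_density hA)
    hMinfm.aestronglyMeasurable
    (by
      filter_upwards [hlim A hA] with ω hω
      exact (ENNReal.tendsto_toReal (measure_ne_top _ _)).comp hω)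
    (ae_tendsto_plugInVariance hmodel hf hf_density hG hlim hA) hs
    (by
      intro n lam hlam
      -- A multiplier known at time `n` is a measurable function of `X_{1:n}`, so the exponential is
      -- a function of the pair `(X_{1:n}, G(A))`.
      obtain ⟨g, hg, rfl⟩ := hlam.exists_eq_measurable_comp
      have hΨ : Measurable fun p : (Fin n → 𝕏) × ℝ => Complex.exp
          ((g p.1 * (p.2 - (finiteRule f G0 α n p.1 : Measure Θ).real A) : ℝ) * Complex.I) :=
        ((Complex.measurable_ofReal.comp ((hg.comp measurable_fst).mul (measurable_snd.sub
          ((measurable_finiteRule_real hf hA n).comp measurable_fst)))).mul_const _).cexp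
      refine condExp_prod_ae_eq_integral_condDistrib (measurable_upTo hX n) hMinfm.aemeasurable
        hΨ.stronglyMeasurable ?_
      exact Integrable.of_bound (hΨ.comp ((measurable_upTo hX n).prodMk
        hMinfm)).aestronglyMeasurable 1 (ae_of_all _ fun ω => (Complex.norm_exp_ofReal_mul_I _).le))
    -- The steps after time `n` have weights from index `n + 1` on, while the supremum starts at
    -- `n`; hence the shift by one.
    (fun n k => le_ciSup (hbdd n) (k + 1)) (fun n => Real.sqrt_nonneg _)
    (hrs.congr' (by
      filter_upwards [hr0] with n hn
      rw [Real.sq_sqrt hn.le])) hrb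
  filter_upwards [hmain] with ω hω hpos s hfr
  exact tendsto_map_gaussianReal (hω hpos) hfr

/-- Conditional central limit theorem and asymptotic credible intervals for Newton's rule. -/
theorem IsNewtonModel.condGaussianLimit_and_credibleInterval
    [TopologicalSpace Θ] [TopologicalSpace.MetrizableSpace Θ]
    [SecondCountableTopology Θ] [BorelSpace Θ] (hmodel : IsNewtonModel μ f G0 α P X θ)
    (hf : Measurable (Function.uncurry f)) (hf_density : ∀ θ, ∫⁻ x, (f x θ : ℝ≥0∞) ∂μ = 1)
    {r : ℕ → ℝ} (hs : Summable fun n => (α n : ℝ) ^ 2)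
    (hrs : Tendsto (fun n => r n * ∑' k, (α (n + k + 1) : ℝ) ^ 2) atTop (𝓝 1))
    (hrb : Tendsto (fun n => √(r n) * ⨆ k, (α (n + k) : ℝ)) atTop (𝓝 0))
    {A : Set Θ} (hA : MeasurableSet A) :
    CondGaussianLimit μ f G0 α P X r A ∧ AsymptoticCredibleInterval μ f G0 α P X r A := by
  have hX := hmodel.measurable_obs
  obtain ⟨G, hG, hlim, hGlim⟩ := exists_ae_eq_limitMixing hmodel hf hf_density
  set Minf : Ω → ℝ := fun ω => (G ω : Measure Θ).real A with hMinf
  have hMinfm : Measurable Minf := ((Measure.measurable_coe hA).comp hG).ennreal_toReal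
  have hclt := hmodel.ae_tendsto_map_condDistrib hf hf_density hG hlim hs hrs hrb hA
  have : NullSingletonClass (gaussianReal 0 1) := nullSingletonClass_gaussianReal one_ne_zero
  constructor
  · have h1 : ∀ᵐ ω ∂P, ∀ n, condDistrib (fun ω' => √(r n) *
        (((limitMixing f G0 α (path X ω') : Measure Θ).real A
          - (newtonRule f G0 α (path X ω') n : Measure Θ).real A)
            / √(plugInVariance μ f A (newtonRule f G0 α (path X ω') n))))
        (upTo X n) P (upTo X n ω) = (condDistrib Minf (upTo X n) P (upTo X n ω)).map fun y =>
          √(r n) / √(plugInVariance μ f A (finiteRule f G0 α n (upTo X n ω))) *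
            (y - (finiteRule f G0 α n (upTo X n ω) : Measure Θ).real A) := by
      rw [ae_all_iff]
      intro n
      have hφ : Measurable fun p : (Fin n → 𝕏) × ℝ =>
          √(r n) / √(plugInVariance μ f A (finiteRule f G0 α n p.1)) *
            (p.2 - (finiteRule f G0 α n p.1 : Measure Θ).real A) :=
        ((((measurable_plugInVariance_finiteRule hf hf_density hA n).comp
          measurable_fst).sqrt).const_div _).mul (measurable_snd.sub
            ((measurable_finiteRule_real hf hA n).comp measurable_fst))
      -- `limitMixing` is replaced by the measurable version `G`; almost sure equality does not
      -- change a conditional distribution. Both forms of the ratio are `0` when the plug-in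
      -- variance is `0`.
      rw [condDistrib_congr_left (Y' := fun ω => √(r n) /
        √(plugInVariance μ f A (finiteRule f G0 α n (upTo X n ω))) *
            (Minf ω - (finiteRule f G0 α n (upTo X n ω) : Measure Θ).real A))]
      · exact ae_condDistrib_comp_prod (measurable_upTo hX n) hMinfm.aemeasurable hφ
      · filter_upwards [hGlim] with ω hω
        rw [hω.1, finiteRule_upTo]
        ring
    filter_upwards [h1, hclt, hGlim] with ω h1 h2 h3 hpos t
    rw [limitVariance_eq_plugInVariance hf, h3.1] at hpos
    simp only [h1]
    rw [cdf_eq_real]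
    exact h2 hpos (Set.Iic t) (by rw [frontier_Iic]; exact measure_singleton t)
  · have h1 : ∀ n, condDistrib (fun ω' => (limitMixing f G0 α (path X ω') : Measure Θ).real A)
        (upTo X n) P = condDistrib Minf (upTo X n) P := fun n => by
      refine condDistrib_congr_left ?_
      filter_upwards [hGlim] with ω hω
      rw [hω.1]
    have hr0 : ∀ᶠ n in atTop, 0 < r n := by
      filter_upwards [hrs.eventually_const_lt one_pos] with n hn
      exact pos_of_mul_pos_left hn (tsum_nonneg fun _ => sq_nonneg _)
    filter_upwards [hclt, hGlim, ae_tendsto_plugInVariance hmodel hf hf_density hG hlim hA]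
      with ω h2 h3 h4 hpos γ z hγ0 hγ1 hz
    rw [limitVariance_eq_plugInVariance hf, h3.1] at hpos
    have h5 := h2 hpos (Set.Ioo (-z) z) (by
      rcases lt_or_ge (-z) z with h | h
      · rw [frontier_Ioo h]
        exact (Set.toFinite _).measure_zero _
      · rw [Set.Ioo_eq_empty (not_lt.2 h)]
        simp)
    rw [gaussianReal_real_Ioo hγ1 hz] at h5
    simp only [h1]
    refine h5.congr' ?_
    -- Once `r n` and the plug-in variance are positive, the credible interval is exactly the
    -- preimage of `(-z, z)` under standardisation.
    filter_upwards [hr0, h4.eventually_const_lt hpos] with n hn hVn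
    have hc : 0 < √(r n) := Real.sqrt_pos.2 hn
    have hv : 0 < √(plugInVariance μ f A (finiteRule f G0 α n (upTo X n ω))) :=
      Real.sqrt_pos.2 hVn
    rw [map_measureReal_apply (by fun_prop) measurableSet_Ioo, ← finiteRule_upTo,
      Real.sqrt_div hVn.le]
    congr 1
    ext y
    set v := √(plugInVariance μ f A (finiteRule f G0 α n (upTo X n ω)))
    set m := (finiteRule f G0 α n (upTo X n ω) : Measure Θ).real A
    have e1 : √(r n) / v * (y - m) = (y - m) / (v / √(r n)) := by field_simp
    have hd : 0 < v / √(r n) := div_pos hv hc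
    simp only [Set.mem_preimage, Set.mem_Ioo]
    rw [e1, lt_div_iff₀ hd, div_lt_iff₀ hd]
    constructor
    · rintro ⟨h, h'⟩
      constructor <;> linarith
    · rintro ⟨h, h'⟩
      constructor <;> linarith

end GaussianLimit

/-! ### Tail sums and rates for the weights `(a + n)^(-β)`. -/

section PolynomialWeights

/-- Comparison of `x ^ (-(c + 1))` with the increments of its primitive. -/
lemma rpow_neg_sub_rpow_neg_bounds {c x : ℝ} (hc : 0 < c) (hx : 0 < x) :
    (x + 1) ^ (-(c + 1)) ≤ x ^ (-c) / c - (x + 1) ^ (-c) / c ∧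
      x ^ (-c) / c - (x + 1) ^ (-c) / c ≤ x ^ (-(c + 1)) := by
  have hder : ∀ y : ℝ, 0 < y → HasDerivAt (fun y : ℝ => y ^ (-c) / c) (-(y ^ (-(c + 1)))) y := by
    intro y hy
    have h := (Real.hasDerivAt_rpow_const (p := -c) (Or.inl hy.ne')).div_const c
    have e : -c * y ^ (-c - 1) / c = -(y ^ (-(c + 1))) := by
      rw [show -c - 1 = -(c + 1) by ring]
      field_simp
    rwa [e] at h
  -- Mean value theorem on `[x, x + 1]`: the increment is `ξ ^ (-(c + 1))`, and the power is
  -- decreasing.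
  obtain ⟨ξ, ⟨h1, h2⟩, h3⟩ := exists_hasDerivAt_eq_slope (fun y : ℝ => y ^ (-c) / c)
    (fun y => -(y ^ (-(c + 1)))) (lt_add_one x)
    (fun y hy => (hder y (hx.trans_le hy.1)).continuousAt.continuousWithinAt)
    (fun y hy => hder y (hx.trans hy.1))
  rw [add_sub_cancel_left, div_one] at h3
  have h4 : ξ ^ (-(c + 1)) = x ^ (-c) / c - (x + 1) ^ (-c) / c := by linarith
  rw [← h4]
  exact ⟨Real.rpow_le_rpow_of_nonpos (hx.trans h1) h2.le (by linarith),
    Real.rpow_le_rpow_of_nonpos hx h1.le (by linarith)⟩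

variable {u : ℕ → ℝ} {a β : ℝ}

/-- The exponent `-2β` is written as `-(c + 1)` with `c = 2β - 1`, and the base as `x + 1`, to match
`rpow_neg_sub_rpow_neg_bounds`. -/
lemma sq_rpow_neg (ha : 0 < a) (hu : ∀ n : ℕ, 1 ≤ n → u n = (a + n) ^ (-β)) (n k : ℕ) :
    u (n + k + 1) ^ 2 = ((a + n + k) + 1) ^ (-((2 * β - 1) + 1)) := by
  rw [hu _ (Nat.le_add_left _ _), ← Real.rpow_mul_natCast (by positivity)]
  push_cast
  congr 1 <;> ring

lemma summable_sq_of_eq_rpow (ha : 0 < a) (hβ : 1 / 2 < β)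
    (hu : ∀ n : ℕ, 1 ≤ n → u n = (a + n) ^ (-β)) : Summable fun n => u n ^ 2 := by
  have hc : 0 < 2 * β - 1 := by linarith
  rw [← summable_nat_add_iff 1]
  refine summable_of_sum_range_le (c := a ^ (-(2 * β - 1)) / (2 * β - 1))
    (fun _ => sq_nonneg _) fun K => ?_
  have h1 : ∀ k : ℕ, u (k + 1) ^ 2 ≤ (a + k) ^ (-(2 * β - 1)) / (2 * β - 1)
      - (a + (k + 1 : ℕ)) ^ (-(2 * β - 1)) / (2 * β - 1) := fun k => by
    have h := (rpow_neg_sub_rpow_neg_bounds hc (show 0 < a + k by positivity)).1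
    have e := sq_rpow_neg ha hu 0 k
    simp only [Nat.cast_zero, add_zero, zero_add] at e
    rw [e]
    push_cast
    rwa [← add_assoc]
  refine (Finset.sum_le_sum fun k _ => h1 k).trans ?_
  rw [Finset.sum_range_sub' (fun k : ℕ => (a + k) ^ (-(2 * β - 1)) / (2 * β - 1))]
  have h2 : 0 ≤ (a + K) ^ (-(2 * β - 1)) / (2 * β - 1) := by positivity
  simp only [Nat.cast_zero, add_zero]
  linarith

/-- Both comparisons with the primitive telescope. The boundary term tends to zero in the lower
bound and is dropped as nonnegative in the upper one. -/
lemma tsum_sq_bounds (ha : 0 < a) (hβ : 1 / 2 < β)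
    (hu : ∀ n : ℕ, 1 ≤ n → u n = (a + n) ^ (-β)) (n : ℕ) :
    (a + n + 1) ^ (-(2 * β - 1)) / (2 * β - 1) ≤ ∑' k, u (n + k + 1) ^ 2 ∧
      ∑' k, u (n + k + 1) ^ 2 ≤ (a + n) ^ (-(2 * β - 1)) / (2 * β - 1) := by
  set c := 2 * β - 1 with hcdef
  have hc : 0 < c := by linarith
  have hs : Summable fun k => u (n + k + 1) ^ 2 := by
    refine ((summable_nat_add_iff (n + 1)).2 (summable_sq_of_eq_rpow ha hβ hu)).congr fun k => ?_
    rw [show k + (n + 1) = n + k + 1 by ring]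
  have hlim := hs.hasSum.tendsto_sum_nat
  have hT : ∀ b : ℝ, Tendsto (fun K : ℕ => (b + K) ^ (-c) / c) atTop (𝓝 0) := fun b => by
    have h := ((tendsto_rpow_neg_atTop hc).comp
      (tendsto_atTop_add_const_left atTop b tendsto_natCast_atTop_atTop)).div_const c
    rwa [zero_div] at h
  constructor
  · have h1 : Tendsto (fun K : ℕ => (a + n + 1) ^ (-c) / c - ((a + n + 1) + K) ^ (-c) / c) atTop
        (𝓝 ((a + n + 1) ^ (-c) / c)) := by
      simpa using (hT (a + n + 1)).const_sub ((a + n + 1) ^ (-c) / c)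
    refine le_of_tendsto_of_tendsto' h1 hlim fun K => ?_
    have h2 : ∀ k : ℕ, (a + n + 1 + k) ^ (-c) / c - (a + n + 1 + (k + 1 : ℕ)) ^ (-c) / c
        ≤ u (n + k + 1) ^ 2 := fun k => by
      have h := (rpow_neg_sub_rpow_neg_bounds hc (show 0 < a + n + 1 + k by positivity)).2
      rw [sq_rpow_neg ha hu, show a + n + k + 1 = a + n + 1 + (k : ℝ) by ring]
      push_cast
      rwa [← add_assoc]
    have h3 := Finset.sum_le_sum fun k (_ : k ∈ Finset.range K) => h2 k
    rw [Finset.sum_range_sub' (fun k : ℕ => (a + n + 1 + k) ^ (-c) / c)] at h3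
    simpa using h3
  · refine le_of_tendsto' hlim fun K => ?_
    have h2 : ∀ k : ℕ, u (n + k + 1) ^ 2
        ≤ (a + n + k) ^ (-c) / c - (a + n + (k + 1 : ℕ)) ^ (-c) / c := fun k => by
      have h := (rpow_neg_sub_rpow_neg_bounds hc (show 0 < a + n + k by positivity)).1
      rw [sq_rpow_neg ha hu]
      push_cast
      rwa [← add_assoc]
    have h3 := Finset.sum_le_sum fun k (_ : k ∈ Finset.range K) => h2 k
    rw [Finset.sum_range_sub' (fun k : ℕ => (a + n + k) ^ (-c) / c)] at h3
    have h4 : 0 ≤ (a + n + K) ^ (-c) / c := by positivity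
    simp only [Nat.cast_zero, add_zero] at h3
    linarith

lemma tendsto_natCast_rpow_mul_rpow_neg (b c : ℝ) (hb : 0 < b) :
    Tendsto (fun n : ℕ => (n : ℝ) ^ c * (b + n) ^ (-c)) atTop (𝓝 1) := by
  have h1 : Tendsto (fun n : ℕ => ((n : ℝ) / (b + n))) atTop (𝓝 1) := by
    simpa [add_comm] using tendsto_natCast_div_add_atTop b
  have h2 := h1.rpow_const (p := c) (Or.inl one_ne_zero)
  rw [Real.one_rpow] at h2
  refine h2.congr fun n => ?_
  have hbn : 0 ≤ b + n := by positivity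
  rw [Real.div_rpow n.cast_nonneg hbn, Real.rpow_neg hbn, div_eq_mul_inv]

/-- With `c = 2β - 1`, the product lies between `n^c (a + 1 + n)^(-c)` and `n^c (a + n)^(-c)`, both
tending to `1`. -/
lemma tendsto_rate_mul_tsum_sq (ha : 0 < a) (hβ : 1 / 2 < β)
    (hu : ∀ n : ℕ, 1 ≤ n → u n = (a + n) ^ (-β)) :
    Tendsto (fun n : ℕ => (2 * β - 1) * (n : ℝ) ^ (2 * β - 1) * ∑' k, u (n + k + 1) ^ 2) atTop
      (𝓝 1) := by
  have hc : 0 < 2 * β - 1 := by linarith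
  refine tendsto_of_tendsto_of_tendsto_of_le_of_le
    (tendsto_natCast_rpow_mul_rpow_neg (a + 1) (2 * β - 1) (by positivity))
    (tendsto_natCast_rpow_mul_rpow_neg a (2 * β - 1) ha) (fun n => ?_) (fun n => ?_)
  · have h := mul_le_mul_of_nonneg_left (tsum_sq_bounds ha hβ hu n).1
      (show 0 ≤ (2 * β - 1) * (n : ℝ) ^ (2 * β - 1) by positivity)
    refine le_trans (le_of_eq ?_) h
    simp only
    rw [show a + 1 + (n : ℝ) = a + n + 1 by ring]
    field_simp
  · have h := mul_le_mul_of_nonneg_left (tsum_sq_bounds ha hβ hu n).2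
      (show 0 ≤ (2 * β - 1) * (n : ℝ) ^ (2 * β - 1) by positivity)
    refine h.trans (le_of_eq ?_)
    field_simp

/-- For `n ≥ 1` the supremum is at most `n^(-β)`, and multiplying by the root of the rate leaves
`√((2β - 1) / n)`. -/
lemma tendsto_sqrt_rate_mul_iSup (ha : 0 < a) (hβ : 1 / 2 < β)
    (hu0 : ∀ n, 0 ≤ u n) (hu : ∀ n : ℕ, 1 ≤ n → u n = (a + n) ^ (-β)) :
    Tendsto (fun n : ℕ => √((2 * β - 1) * (n : ℝ) ^ (2 * β - 1)) * ⨆ k, u (n + k)) atTop (𝓝 0) := by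
  have hc : 0 < 2 * β - 1 := by linarith
  have h1 : Tendsto (fun n : ℕ => √((2 * β - 1) * (n : ℝ)⁻¹)) atTop (𝓝 0) := by
    have h := (Real.continuous_sqrt.tendsto _).comp
      ((tendsto_inv_atTop_nhds_zero_nat (𝕜 := ℝ)).const_mul (2 * β - 1))
    rwa [mul_zero, Real.sqrt_zero] at h
  refine squeeze_zero' (Eventually.of_forall fun n =>
    mul_nonneg (Real.sqrt_nonneg _) (Real.iSup_nonneg fun k => hu0 _)) ?_ h1
  filter_upwards [eventually_ge_atTop 1] with n hn
  have hn0 : (0 : ℝ) < n := by exact_mod_cast hn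
  have hsup : ⨆ k, u (n + k) ≤ (n : ℝ) ^ (-β) := ciSup_le fun k => by
    rw [hu _ (by omega)]
    refine Real.rpow_le_rpow_of_nonpos hn0 ?_ (by linarith)
    push_cast
    have : (0 : ℝ) ≤ k := k.cast_nonneg
    linarith
  have hpos : (0 : ℝ) ≤ (n : ℝ) ^ (-β) := by positivity
  calc √((2 * β - 1) * (n : ℝ) ^ (2 * β - 1)) * ⨆ k, u (n + k)
      ≤ √((2 * β - 1) * (n : ℝ) ^ (2 * β - 1)) * (n : ℝ) ^ (-β) :=
        mul_le_mul_of_nonneg_left hsup (Real.sqrt_nonneg _)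
    _ = √((2 * β - 1) * (n : ℝ) ^ (2 * β - 1)) * √(((n : ℝ) ^ (-β)) ^ 2) := by
        rw [Real.sqrt_sq hpos]
    _ = √((2 * β - 1) * (n : ℝ)⁻¹) := by
        rw [← Real.sqrt_mul (by positivity), mul_assoc, ← Real.rpow_mul_natCast hn0.le,
          ← Real.rpow_add hn0, ← Real.rpow_neg_one]
        congr 3
        push_cast
        ring

end PolynomialWeights

end NewtonMixture

end

/-! ### The theorem. -/

theorem mainTheorem6 {𝕏 Θ Ω : Type*}
    [MeasurableSpace 𝕏] [StandardBorelSpace 𝕏] [Nonempty 𝕏]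
    [TopologicalSpace Θ] [TopologicalSpace.MetrizableSpace Θ] [SecondCountableTopology Θ]
    [MeasurableSpace Θ] [BorelSpace Θ] [StandardBorelSpace Θ] [Nonempty Θ]
    [MeasurableSpace Ω] (P : Measure Ω) [IsProbabilityMeasure P]
    (μ : Measure 𝕏) [SigmaFinite μ]
    (f : 𝕏 → Θ → ℝ≥0) (hf : Measurable (Function.uncurry f))
    (hf_density : ∀ θ, ∫⁻ x, (f x θ : ℝ≥0∞) ∂μ = 1)
    (G0 : ProbabilityMeasure Θ) (α : ℕ → Set.Ioo (0 : ℝ) 1)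
    (X : ℕ → Ω → 𝕏) (θ : ℕ → Ω → Θ)
    (hmodel : NewtonMixture.IsNewtonModel μ f G0 α P X θ) :
    -- `G` is indeed the almost sure weak limit of `G_n`
    (∀ᵐ ω ∂P, Tendsto (NewtonMixture.newtonRule f G0 α (NewtonMixture.path X ω)) atTop
      (𝓝 (NewtonMixture.limitMixing f G0 α (NewtonMixture.path X ω)))) ∧
    -- general weights and rates
    (∀ r : ℕ → ℝ,
      ¬ Summable (fun n => (α n : ℝ)) →
      Summable (fun n => (α n : ℝ) ^ 2) →
      MonotoneOn r (Set.Ici 1) →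
      (∀ n, 1 ≤ n → 0 < r n) →
      Asymptotics.IsEquivalent atTop r (fun n : ℕ => (∑' k : ℕ, (α (n + 1 + k) : ℝ) ^ 2)⁻¹) →
      Tendsto (fun n : ℕ => √(r n) * ⨆ k : ℕ, (α (n + k) : ℝ)) atTop (𝓝 0) →
      Summable (fun k : ℕ => r k ^ 2 * (α (k + 1) : ℝ) ^ 4) →
      ∀ A : Set Θ, MeasurableSet A →
        NewtonMixture.CondGaussianLimit μ f G0 α P X r A ∧
        NewtonMixture.AsymptoticCredibleInterval μ f G0 α P X r A) ∧
    -- the weights `α_n = (a + n)^(-β)` with the rate `r_n = (2β - 1) n^(2β - 1)`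
    (∀ a β : ℝ, 0 < a → 1 / 2 < β → β ≤ 1 →
      (∀ n : ℕ, 1 ≤ n → (α n : ℝ) = (a + n) ^ (-β)) →
      ∀ A : Set Θ, MeasurableSet A →
        NewtonMixture.CondGaussianLimit μ f G0 α P X
          (fun n : ℕ => (2 * β - 1) * (n : ℝ) ^ (2 * β - 1)) A ∧
        NewtonMixture.AsymptoticCredibleInterval μ f G0 α P X
          (fun n : ℕ => (2 * β - 1) * (n : ℝ) ^ (2 * β - 1)) A) := by
  obtain ⟨G, hG, hlim, hGlim⟩ := NewtonMixture.exists_ae_eq_limitMixing hmodel hf hf_density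
  refine ⟨?_, ?_, ?_⟩
  · filter_upwards [hGlim] with ω hω
    rw [hω.1]
    exact hω.2
  · intro r _ hs _ _ hequiv hrb _ A hA
    have hswap : ∀ n, ∑' k, (α (n + k + 1) : ℝ) ^ 2 = ∑' k, (α (n + 1 + k) : ℝ) ^ 2 := fun n => by
      simp only [Nat.add_right_comm]
    have hpos : ∀ n, 0 < ∑' k, (α (n + 1 + k) : ℝ) ^ 2 := fun n => by
      have hs' : Summable fun k => (α (n + 1 + k) : ℝ) ^ 2 :=
        ((summable_nat_add_iff (n + 1)).2 hs).congr fun k => by rw [Nat.add_comm]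
      exact hs'.tsum_pos (fun _ => sq_nonneg _) 0 (pow_pos (α _).2.1 2)
    refine hmodel.condGaussianLimit_and_credibleInterval hf hf_density hs ?_ hrb hA
    -- The tail sums are positive because every weight is, so the equivalence says that `r n` times
    -- the tail sum tends to `1`.
    have h := (Asymptotics.isEquivalent_iff_tendsto_one
      (Filter.Eventually.of_forall fun n => (inv_pos.2 (hpos n)).ne')).1 hequiv
    refine h.congr fun n => ?_
    rw [hswap, Pi.div_apply, div_inv_eq_mul]
  · intro a β ha hβ _ hα A hA
    exact hmodel.condGaussianLimit_and_credibleInterval hf hf_density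
      (NewtonMixture.summable_sq_of_eq_rpow (u := fun n => (α n : ℝ)) ha hβ hα)
      (NewtonMixture.tendsto_rate_mul_tsum_sq (u := fun n => (α n : ℝ)) ha hβ hα)
      (NewtonMixture.tendsto_sqrt_rate_mul_iSup (u := fun n => (α n : ℝ)) ha hβ
        (fun n => (α n).2.1.le) hα) hA
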